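/- Let $\Omega\subset\mathbb{C}^2$ be a bounded pseudoconvex domain with smooth ($C^\infty$) boundary. A defining function of $\Omega$ is a real function $r$, smooth on a neighbourhood $U$ of $\overline\Omega$, with $\Omega=\{z\in U: r(z)<0\}$ and $dr\ne 0$ on $\partial\Omega$. For a real function $r$ put $$\mathrm{Hess}_r(X,Y)=\sum_{j,k=1}^{2}\frac{\partial^2 r}{\partial z_j\,\partial\bar z_k}X_j\overline{Y_k}\qquad\Big(X=\sum_j X_j\tfrac{\partial}{\partial z_j},\ Y=\sum_k Y_k\tfrac{\partial}{\partial z_k}\Big).$$ Pseudoconvexity means that $\mathrm{Hess}_r(X,X)\ge 0$ at every $p\in\partial\Omega$ for all holomorphic tangent vectors $X$ (those with $\sum_j \frac{\partial r}{\partial z_j}(p)X_j=0$), where $r$ is a defining function. Let $\Sigma\subset\partial\Omega$ be the set of Levi-flat boundary points, that is, of the points at which $\mathrm{Hess}_r(X,X)=0$ for all such $X$. (Neither notion depends on the choice of $r$.) Suppose that there is a defining function $r$ of $\Omega$ such that $$\mathrm{Hess}_r(L,N)=0\quad\text{at every point of }\Sigma,$$ where, with coordinates $(z,w)$ on $\mathbb{C}^2$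 and $|\partial r|=\sqrt{|\frac{\partial r}{\partial z}|^2+|\frac{\partial r}{\partial w}|^2}$, $$L=\frac1{|\partial r|}\Big(\frac{\partial r}{\partial w}\frac{\partial}{\partial z}-\frac{\partial r}{\partial z}\frac{\partial}{\partial w}\Big),\qquad N=\frac1{|\partial r|}\Big(\frac{\partial r}{\partial\bar z}\frac{\partial}{\partial z}+\frac{\partial r}{\partial\bar w}\frac{\partial}{\partial w}\Big)$$ are the normalized holomorphic tangential field and the normalized complex normal field. Then the Diederich–Fornæss index of $\Omega$ equals $1$; here the index is the supremum of all $\tau\in(0,1)$ for which there is a defining function $\rho$ of $\Omega$ such that $-(-\rho)^{\tau}$ is plurisubharmonic on $\Omega$. -/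

import Mathlib

open scoped ContDiff

noncomputable section

namespace DiederichFornaess

/-- Complex Euclidean space of dimension two, with coordinates `z 0` and `z 1`. -/
abbrev C2 : Type := EuclideanSpace ℂ (Fin 2)

/-- The Wirtinger derivative `∂f/∂z_j = (1/2) (∂f/∂x_j - i ∂f/∂y_j)`, where `z_j = x_j + i y_j`. -/
def wirt (j : Fin 2) (f : C2 → ℂ) (p : C2) : ℂ :=
  (1 / 2) * (fderiv ℝ f p (EuclideanSpace.single j 1)
    - Complex.I * fderiv ℝ f p (EuclideanSpace.single j Complex.I))

/-- The Wirtinger derivative `∂f/∂z̄_j = (1/2) (∂f/∂x_j + i ∂f/∂y_j)`. -/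
def wirtBar (j : Fin 2) (f : C2 → ℂ) (p : C2) : ℂ :=
  (1 / 2) * (fderiv ℝ f p (EuclideanSpace.single j 1)
    + Complex.I * fderiv ℝ f p (EuclideanSpace.single j Complex.I))

/-- A real function, regarded as a complex-valued one. -/
def toComplex (r : C2 → ℝ) : C2 → ℂ := fun z => (r z : ℂ)

/-- The complex Hessian `Hess_r(X, Y) = ∑ j k, (∂²r/∂z_j∂z̄_k)(p) X_j conj(Y_k)` of a real function
at `p`, on the holomorphic vectors `X = ∑ j, X_j ∂/∂z_j` and `Y = ∑ k, Y_k ∂/∂z_k`. -/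
def complexHessian (r : C2 → ℝ) (p X Y : C2) : ℂ :=
  ∑ j, ∑ k, wirt j (wirtBar k (toComplex r)) p * X j * starRingEnd ℂ (Y k)

/-- `r` is a smooth defining function of `Ω`: it is `C^∞` on an open neighbourhood `U` of the closure
of `Ω`, `Ω` is the set of the points of `U` at which `r` is negative, and the differential of `r`
vanishes nowhere on the boundary. The existence of one says that the boundary of `Ω` is smooth. -/
def IsDefiningFunction (Ω : Set C2) (r : C2 → ℝ) : Prop :=
  (∃ U : Set C2, IsOpen U ∧ closure Ω ⊆ U ∧ ContDiffOn ℝ ∞ r U ∧ ∀ z ∈ U, z ∈ Ω ↔ r z < 0) ∧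
    ∀ p ∈ frontier Ω, fderiv ℝ r p ≠ 0

/-- `X = ∑ j, X_j ∂/∂z_j` is tangent at `p` to the level set of `r`, that is, `X(r) = 0`. -/
def IsComplexTangent (r : C2 → ℝ) (p X : C2) : Prop :=
  ∑ j, wirt j (toComplex r) p * X j = 0

/-- The boundary of `Ω` is smooth and `Ω` is (Levi) pseudoconvex: the Levi form is nonnegative on the
holomorphic tangent space at each boundary point. Two defining functions have Levi forms that differ
by a positive factor, so it does not matter which one is used. -/
def IsPseudoconvex (Ω : Set C2) : Prop :=
  ∃ r : C2 → ℝ, IsDefiningFunction Ω r ∧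
    ∀ p ∈ frontier Ω, ∀ X : C2, IsComplexTangent r p X → 0 ≤ (complexHessian r p X X).re

/-- The set of Levi-flat boundary points: those at which the Levi form vanishes. Again it does not
matter which defining function is used. -/
def leviFlatSet (Ω : Set C2) : Set C2 :=
  {p | p ∈ frontier Ω ∧ ∃ r : C2 → ℝ, IsDefiningFunction Ω r ∧
    ∀ X : C2, IsComplexTangent r p X → complexHessian r p X X = 0}

/-- `(|∂r/∂z|² + |∂r/∂w|²)^(1/2)`. -/
def gradNorm (r : C2 → ℝ) (p : C2) : ℝ :=
  Real.sqrt (‖wirt 0 (toComplex r) p‖ ^ 2 + ‖wirt 1 (toComplex r) p‖ ^ 2)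

/-- The normalized holomorphic tangential field
`L = (|∂r/∂z|² + |∂r/∂w|²)^(-1/2) (∂r/∂w ∂/∂z - ∂r/∂z ∂/∂w)`. -/
def tangentialField (r : C2 → ℝ) (p : C2) : C2 :=
  ((gradNorm r p)⁻¹ : ℂ) • !₂[wirt 1 (toComplex r) p, -wirt 0 (toComplex r) p]

/-- The normalized complex normal field
`N = (|∂r/∂z|² + |∂r/∂w|²)^(-1/2) (∂r/∂z̄ ∂/∂z + ∂r/∂w̄ ∂/∂w)`. -/
def normalField (r : C2 → ℝ) (p : C2) : C2 :=
  ((gradNorm r p)⁻¹ : ℂ) • !₂[wirtBar 0 (toComplex r) p, wirtBar 1 (toComplex r) p]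

/-- A (finite-valued) function is plurisubharmonic on `Ω` if it is upper semicontinuous there and, on
each closed complex affine disc inside `Ω`, its value at the centre is at most its mean over the
bounding circle. A finite value at the centre forces it to be integrable over the circle. -/
def IsPlurisubharmonicOn (u : C2 → ℝ) (Ω : Set C2) : Prop :=
  UpperSemicontinuousOn u Ω ∧
    ∀ z ∈ Ω, ∀ w : C2, (∀ ζ : ℂ, ‖ζ‖ ≤ 1 → z + ζ • w ∈ Ω) →
      CircleIntegrable (fun ζ : ℂ => u (z + ζ • w)) 0 1 ∧
        u z ≤ Real.circleAverage (fun ζ : ℂ => u (z + ζ • w)) 0 1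

/-- The Diederich–Fornæss exponents of `Ω`: the `τ` in `(0, 1)` such that `-(-ρ)^τ` is
plurisubharmonic on `Ω` for some smooth defining function `ρ` of `Ω`. -/
def exponents (Ω : Set C2) : Set ℝ :=
  {τ | 0 < τ ∧ τ < 1 ∧ ∃ ρ : C2 → ℝ, IsDefiningFunction Ω ρ ∧
    IsPlurisubharmonicOn (fun z => -((-ρ z) ^ τ)) Ω}

/-- The Diederich–Fornæss index, the supremum of the exponents. The set of exponents is bounded
above by `1`; with no exponent at all, the value is `0`. -/
def index (Ω : Set C2) : ℝ := sSup (exponents Ω)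

end DiederichFornaess

end

noncomputable section

open Filter Topology

namespace DiederichFornaess

/-! ### Wirtinger calculus for globally smooth functions -/

/-! Every `τ` in `(0, 1)` is shown to be an exponent, with a defining function that equals `r
e^{-ψ}` near the boundary for a weight `ψ` depending on `τ`. Write `L`, `N` for the unnormalised
fields `tang`, `nrm`, and `s`, `F`, `g` for `gradSq`, `leviFn`, `mixFn`. Up to a positive factor,
the complex Hessian of `-(-r e^{-ψ})^τ` is `condForm`. In the frame `L`, `N` it is a Hermitian 2×2
form with diagonal entries `F + (-r) * tangCoeff` and `nrmCoeff / (-r)` and off-diagonal entry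
`crossCoeff`. If `F ≥ l (-r)` near a boundary point, the factors `-r` cancel in the determinant, and
nonnegativity near that point follows from strict inequalities at the point alone
(`condForm_nonneg_near`).

Where `F > 0`, any `l` is allowed and can be taken as large as needed. At a Levi-flat point, `l` is
limited by the normal derivative of `F`. The hypothesis enters here: `F = g = 0` puts `L` in the
kernel of the complex Hessian, and symmetry of third derivatives then gives `N F = L g`
(`holDeriv_leviFn_nrm`). So the possible loss is about `|Lg| / s`. The weight `ψ = M |g|² + κ |z|²`
pays for it: where `g = 0`, its Hessian on `L` is at least `M |Lg|² + κ s`, while its first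
derivatives come from `κ |z|²` only. Thus `κ` can be fixed small to control the cross term, and `M`
taken large afterwards (`exists_weight_condForm_nonneg`).

Two further points remain. The form is controlled only in a collar of the boundary; composing `log
(-r) - ψ` with a concave function that becomes constant away from the boundary makes the result
plurisubharmonic on the whole domain (`sndDeriv_exp_cutoff_nonneg`,
`mem_exponents_of_condForm_nonneg`). And pseudoconvexity may be witnessed by another defining
function than `r`, so the sign of the Levi form has to be transferred (`re_leviFn_nonneg_of_sign`).
-/

lemma differentiable_of_smooth {E F : Type*} [NormedAddCommGroup E] [NormedSpace ℝ E]
    [NormedAddCommGroup F] [NormedSpace ℝ F] {f : E → F} (hf : ContDiff ℝ ∞ f) :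
    Differentiable ℝ f := hf.differentiable (by simp)

lemma contDiff_fderiv_apply_const {E F : Type*} [NormedAddCommGroup E] [NormedSpace ℝ E]
    [NormedAddCommGroup F] [NormedSpace ℝ F] {f : E → F} (hf : ContDiff ℝ ∞ f) (v : E) :
    ContDiff ℝ ∞ (fun p => fderiv ℝ f p v) :=
  (hf.fderiv_right (m := ∞) (by simp)).clm_apply contDiff_const

lemma contDiff_wirt {f : C2 → ℂ} (hf : ContDiff ℝ ∞ f) (j : Fin 2) :
    ContDiff ℝ ∞ (wirt j f) := by
  unfold wirt
  exact contDiff_const.mul ((contDiff_fderiv_apply_const hf _).sub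
    (contDiff_const.mul (contDiff_fderiv_apply_const hf _)))

lemma contDiff_wirtBar {f : C2 → ℂ} (hf : ContDiff ℝ ∞ f) (j : Fin 2) :
    ContDiff ℝ ∞ (wirtBar j f) := by
  unfold wirtBar
  exact contDiff_const.mul ((contDiff_fderiv_apply_const hf _).add
    (contDiff_const.mul (contDiff_fderiv_apply_const hf _)))

lemma contDiff_toComplex {r : C2 → ℝ} (hr : ContDiff ℝ ∞ r) : ContDiff ℝ ∞ (toComplex r) :=
  Complex.ofRealCLM.contDiff.comp hr

lemma contDiff_conj {f : C2 → ℂ} (hf : ContDiff ℝ ∞ f) :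
    ContDiff ℝ ∞ (fun p => starRingEnd ℂ (f p)) :=
  Complex.conjCLE.contDiff.comp hf

lemma wirt_add {f g : C2 → ℂ} (hf : Differentiable ℝ f) (hg : Differentiable ℝ g) (j : Fin 2)
    (p : C2) : wirt j (fun q => f q + g q) p = wirt j f p + wirt j g p := by
  simp only [wirt, fderiv_fun_add (hf p) (hg p), add_apply]; ring

lemma wirt_sub {f g : C2 → ℂ} (hf : Differentiable ℝ f) (hg : Differentiable ℝ g) (j : Fin 2)
    (p : C2) : wirt j (fun q => f q - g q) p = wirt j f p - wirt j g p := by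
  simp only [wirt, fderiv_fun_sub (hf p) (hg p), sub_apply]; ring

lemma wirt_mul {f g : C2 → ℂ} (hf : Differentiable ℝ f) (hg : Differentiable ℝ g) (j : Fin 2)
    (p : C2) : wirt j (fun q => f q * g q) p = wirt j f p * g p + f p * wirt j g p := by
  simp only [wirt, fderiv_fun_mul (hf p) (hg p), add_apply,
    smul_apply, smul_eq_mul]; ring

lemma wirtBar_add {f g : C2 → ℂ} (hf : Differentiable ℝ f) (hg : Differentiable ℝ g) (j : Fin 2)
    (p : C2) : wirtBar j (fun q => f q + g q) p = wirtBar j f p + wirtBar j g p := by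
  simp only [wirtBar, fderiv_fun_add (hf p) (hg p), add_apply]; ring

lemma wirtBar_mul {f g : C2 → ℂ} (hf : Differentiable ℝ f) (hg : Differentiable ℝ g) (j : Fin 2)
    (p : C2) : wirtBar j (fun q => f q * g q) p = wirtBar j f p * g p + f p * wirtBar j g p := by
  simp only [wirtBar, fderiv_fun_mul (hf p) (hg p), add_apply,
    smul_apply, smul_eq_mul]; ring

lemma wirt_const (c : ℂ) (j : Fin 2) (p : C2) : wirt j (fun _ => c) p = 0 := by
  simp [wirt]

lemma wirtBar_const (c : ℂ) (j : Fin 2) (p : C2) : wirtBar j (fun _ => c) p = 0 := by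
  simp [wirtBar]

lemma fderiv_conj {f : C2 → ℂ} (hf : Differentiable ℝ f) (p v : C2) :
    fderiv ℝ (fun q => starRingEnd ℂ (f q)) p v = starRingEnd ℂ (fderiv ℝ f p v) := by
  have h := (Complex.conjCLE.toContinuousLinearMap.hasFDerivAt (x := f p)).comp p
    (hf p).hasFDerivAt
  have h2 : HasFDerivAt (fun q => starRingEnd ℂ (f q))
    (Complex.conjCLE.toContinuousLinearMap.comp (fderiv ℝ f p)) p := h
  rw [h2.fderiv]; rfl

lemma wirt_conj {f : C2 → ℂ} (hf : Differentiable ℝ f) (j : Fin 2) (p : C2) :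
    wirt j (fun q => starRingEnd ℂ (f q)) p = starRingEnd ℂ (wirtBar j f p) := by
  simp only [wirt, wirtBar, fderiv_conj hf, map_mul, map_add, map_div₀, map_one, map_ofNat,
    Complex.conj_I]
  ring

lemma wirtBar_conj {f : C2 → ℂ} (hf : Differentiable ℝ f) (j : Fin 2) (p : C2) :
    wirtBar j (fun q => starRingEnd ℂ (f q)) p = starRingEnd ℂ (wirt j f p) := by
  simp only [wirt, wirtBar, fderiv_conj hf, map_mul, map_sub, map_div₀, map_one, map_ofNat,
    Complex.conj_I]
  ring

lemma conj_wirt_toComplex {r : C2 → ℝ} (hr : ContDiff ℝ ∞ r) (j : Fin 2) (p : C2) :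
    starRingEnd ℂ (wirt j (toComplex r) p) = wirtBar j (toComplex r) p := by
  rw [← wirtBar_conj (differentiable_of_smooth (contDiff_toComplex hr))]
  simp only [toComplex, Complex.conj_ofReal]
  rfl

lemma conj_wirtBar_toComplex {r : C2 → ℝ} (hr : ContDiff ℝ ∞ r) (j : Fin 2) (p : C2) :
    starRingEnd ℂ (wirtBar j (toComplex r) p) = wirt j (toComplex r) p := by
  rw [← conj_wirt_toComplex hr, Complex.conj_conj]

lemma fderiv_fderiv_apply {E F : Type*} [NormedAddCommGroup E] [NormedSpace ℝ E]
    [NormedAddCommGroup F] [NormedSpace ℝ F] {f : E → F} (hf : ContDiff ℝ ∞ f) (p v w : E) :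
    fderiv ℝ (fun q => fderiv ℝ f q v) p w = fderiv ℝ (fderiv ℝ f) p w v := by
  have h : DifferentiableAt ℝ (fderiv ℝ f) p :=
    differentiable_of_smooth (hf.fderiv_right (m := ∞) (by simp)) p
  have := (h.hasFDerivAt.clm_apply (hasFDerivAt_const v p)).fderiv
  rw [this]; simp

lemma fderiv_fderiv_comm {E F : Type*} [NormedAddCommGroup E] [NormedSpace ℝ E]
    [NormedAddCommGroup F] [NormedSpace ℝ F] {f : E → F} (hf : ContDiff ℝ ∞ f) (p v w : E) :
    fderiv ℝ (fderiv ℝ f) p w v = fderiv ℝ (fderiv ℝ f) p v w :=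
  (hf.contDiffAt.isSymmSndFDerivAt (by simp; exact WithTop.coe_le_coe.2 le_top)).eq w v

/-- The derivative of a complex linear combination of directional derivatives. -/
lemma fderiv_lincomb {f : C2 → ℂ} (hf : ContDiff ℝ ∞ f) (c d : ℂ) (u v p w : C2) :
    fderiv ℝ (fun q => c * (fderiv ℝ f q u + d * fderiv ℝ f q v)) p w =
      c * (fderiv ℝ (fderiv ℝ f) p w u + d * fderiv ℝ (fderiv ℝ f) p w v) := by
  have h1 := differentiable_of_smooth (contDiff_fderiv_apply_const hf u)
  have h2 := differentiable_of_smooth (contDiff_fderiv_apply_const hf v)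
  have h3 := (((h1 p).hasFDerivAt.add ((h2 p).hasFDerivAt.const_mul d)).const_mul c).fderiv
  have h4 : fderiv ℝ (fun q => c * (fderiv ℝ f q u + d * fderiv ℝ f q v)) p = _ := h3
  rw [h4]
  simp only [smul_apply, add_apply, smul_eq_mul]
  rw [fderiv_fderiv_apply hf, fderiv_fderiv_apply hf]

lemma wirt_eq_lincomb (j : Fin 2) (f : C2 → ℂ) : wirt j f = fun p =>
    (1 / 2) * (fderiv ℝ f p (EuclideanSpace.single j 1)
    + (-Complex.I) * fderiv ℝ f p (EuclideanSpace.single j Complex.I)) := by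
  funext p; simp only [wirt]; ring

lemma wirtBar_eq_lincomb (j : Fin 2) (f : C2 → ℂ) : wirtBar j f = fun p =>
    (1 / 2) * (fderiv ℝ f p (EuclideanSpace.single j 1)
    + Complex.I * fderiv ℝ f p (EuclideanSpace.single j Complex.I)) := rfl

lemma wirt_wirtBar_comm {f : C2 → ℂ} (hf : ContDiff ℝ ∞ f) (j k : Fin 2) :
    wirt j (wirtBar k f) = wirtBar k (wirt j f) := by
  funext p
  rw [wirt_eq_lincomb j f, wirtBar_eq_lincomb k f]
  simp only [wirt, wirtBar, fderiv_lincomb hf]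
  rw [fderiv_fderiv_comm hf p (EuclideanSpace.single j 1) (EuclideanSpace.single k 1),
    fderiv_fderiv_comm hf p (EuclideanSpace.single j Complex.I) (EuclideanSpace.single k 1),
    fderiv_fderiv_comm hf p (EuclideanSpace.single j 1) (EuclideanSpace.single k Complex.I),
    fderiv_fderiv_comm hf p (EuclideanSpace.single j Complex.I)
      (EuclideanSpace.single k Complex.I)]
  ring

lemma wirt_wirt_comm {f : C2 → ℂ} (hf : ContDiff ℝ ∞ f) (j k : Fin 2) :
    wirt j (wirt k f) = wirt k (wirt j f) := by
  funext p
  rw [wirt_eq_lincomb j f, wirt_eq_lincomb k f]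
  simp only [wirt, fderiv_lincomb hf]
  rw [fderiv_fderiv_comm hf p (EuclideanSpace.single j 1) (EuclideanSpace.single k 1),
    fderiv_fderiv_comm hf p (EuclideanSpace.single j Complex.I) (EuclideanSpace.single k 1),
    fderiv_fderiv_comm hf p (EuclideanSpace.single j 1) (EuclideanSpace.single k Complex.I),
    fderiv_fderiv_comm hf p (EuclideanSpace.single j Complex.I)
      (EuclideanSpace.single k Complex.I)]
  ring

/-! ### Holomorphic derivatives along a vector -/

/-- The derivative `∑ j, X_j ∂f/∂z_j`. -/
def holDeriv (f : C2 → ℂ) (p X : C2) : ℂ := ∑ j, wirt j f p * X j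

lemma apply_eq_of_basis (D : C2 →L[ℝ] ℂ) (X : C2) :
    D X = (X 0).re * D (EuclideanSpace.single 0 1) + (X 0).im * D (EuclideanSpace.single 0 Complex.I)
      + (X 1).re * D (EuclideanSpace.single 1 1)
      + (X 1).im * D (EuclideanSpace.single 1 Complex.I) := by
  have hX : X = (X 0).re • EuclideanSpace.single 0 (1 : ℂ) +
      (X 0).im • EuclideanSpace.single 0 Complex.I + (X 1).re • EuclideanSpace.single 1 (1 : ℂ) +
      (X 1).im • EuclideanSpace.single 1 Complex.I := by
    ext i
    fin_cases i <;> simp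
  conv_lhs => rw [hX]
  simp only [map_add, map_smul, Complex.real_smul]

lemma apply_I_smul_eq_of_basis (D : C2 →L[ℝ] ℂ) (X : C2) :
    D (Complex.I • X) = -(X 0).im * D (EuclideanSpace.single 0 1)
      + (X 0).re * D (EuclideanSpace.single 0 Complex.I)
      - (X 1).im * D (EuclideanSpace.single 1 1)
      + (X 1).re * D (EuclideanSpace.single 1 Complex.I) := by
  rw [apply_eq_of_basis]
  simp
  ring

/-- Replaces Wirtinger sums by real derivatives along `X` and `iX`, so that later arguments can use
real calculus along curves. -/
lemma holDeriv_eq (f : C2 → ℂ) (p X : C2) :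
    holDeriv f p X = (1 / 2) * (fderiv ℝ f p X - Complex.I * fderiv ℝ f p (Complex.I • X)) := by
  rw [apply_eq_of_basis, apply_I_smul_eq_of_basis]
  simp only [holDeriv, Fin.sum_univ_two, wirt]
  conv_lhs => rw [← Complex.re_add_im (X 0), ← Complex.re_add_im (X 1)]
  ring_nf
  simp only [Complex.I_sq]
  ring

lemma antiholDeriv_eq (f : C2 → ℂ) (p X : C2) :
    ∑ j, wirtBar j f p * starRingEnd ℂ (X j) =
      (1 / 2) * (fderiv ℝ f p X + Complex.I * fderiv ℝ f p (Complex.I • X)) := by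
  have hc : ∀ z : ℂ, starRingEnd ℂ z = z.re - z.im * Complex.I := fun z => by
    apply Complex.ext <;> simp
  rw [apply_eq_of_basis, apply_I_smul_eq_of_basis]
  simp only [Fin.sum_univ_two, wirtBar, hc]
  ring_nf
  simp only [Complex.I_sq]
  ring

/-- The real second derivative of `u` at `p`. -/
def sndDeriv {E F : Type*} [NormedAddCommGroup E] [NormedSpace ℝ E]
    [NormedAddCommGroup F] [NormedSpace ℝ F] (u : E → F) (p X Y : E) : F :=
  fderiv ℝ (fderiv ℝ u) p X Y

lemma fderiv_toComplex {r : C2 → ℝ} (hr : ContDiff ℝ ∞ r) (p X : C2) :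
    fderiv ℝ (toComplex r) p X = ((fderiv ℝ r p X : ℝ) : ℂ) := by
  have h := (Complex.ofRealCLM.hasFDerivAt (x := r p)).comp p
    (differentiable_of_smooth hr p).hasFDerivAt
  have h2 : HasFDerivAt (toComplex r) (Complex.ofRealCLM.comp (fderiv ℝ r p)) p := h
  rw [h2.fderiv]; rfl

lemma sndDeriv_toComplex {r : C2 → ℝ} (hr : ContDiff ℝ ∞ r) (p X Y : C2) :
    sndDeriv (toComplex r) p X Y = ((sndDeriv r p X Y : ℝ) : ℂ) := by
  unfold sndDeriv
  rw [← fderiv_fderiv_apply (contDiff_toComplex hr), ← fderiv_fderiv_apply hr]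
  simp_rw [fderiv_toComplex hr]
  exact fderiv_toComplex (contDiff_fderiv_apply_const hr Y) p X

/-- Hermitian part of the real Hessian. Hermitian symmetry and the comparison of Levi forms of
different defining functions are both read off from this formula. -/
lemma complexHessian_eq {r : C2 → ℝ} (hr : ContDiff ℝ ∞ r) (p X Y : C2) :
    complexHessian r p X Y = (1 / 4) * (sndDeriv r p X Y
      + sndDeriv r p (Complex.I • X) (Complex.I • Y)
      + Complex.I * (sndDeriv r p X (Complex.I • Y) - sndDeriv r p (Complex.I • X) Y)) := by
  have hc := contDiff_toComplex hr
  have h1 : complexHessian r p X Y =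
      ∑ j, wirt j (fun q => ∑ k, wirtBar k (toComplex r) q * starRingEnd ℂ (Y k)) p * X j := by
    unfold complexHessian
    have hd : ∀ k, Differentiable ℝ (wirtBar k (toComplex r)) := fun k =>
      differentiable_of_smooth (contDiff_wirtBar hc k)
    have hd' : ∀ k, Differentiable ℝ
        (fun q => wirtBar k (toComplex r) q * starRingEnd ℂ (Y k)) := fun k =>
      (hd k).mul_const _
    have hm : ∀ j k, wirt j (fun q => wirtBar k (toComplex r) q * starRingEnd ℂ (Y k)) p =
        wirt j (wirtBar k (toComplex r)) p * starRingEnd ℂ (Y k) := fun j k => by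
      rw [wirt_mul (hd k) (differentiable_const _), wirt_const]; ring
    refine Finset.sum_congr rfl fun j _ => ?_
    simp only [Fin.sum_univ_two]
    rw [wirt_add (hd' 0) (hd' 1), hm, hm]
    ring
  rw [h1]
  simp_rw [antiholDeriv_eq]
  have h2 := holDeriv_eq (fun q => (1 / 2) * (fderiv ℝ (toComplex r) q Y +
    Complex.I * fderiv ℝ (toComplex r) q (Complex.I • Y))) p X
  unfold holDeriv at h2
  rw [h2, fderiv_lincomb hc, fderiv_lincomb hc]
  have hs := sndDeriv_toComplex hr p
  unfold sndDeriv at hs ⊢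
  simp only [hs]
  ring_nf
  simp only [Complex.I_sq]
  ring

lemma re_complexHessian_self {r : C2 → ℝ} (hr : ContDiff ℝ ∞ r) (p X : C2) :
    (complexHessian r p X X).re =
      (1 / 4) * (sndDeriv r p X X + sndDeriv r p (Complex.I • X) (Complex.I • X)) := by
  have h : sndDeriv r p (Complex.I • X) X = sndDeriv r p X (Complex.I • X) :=
    fderiv_fderiv_comm hr p X (Complex.I • X)
  rw [complexHessian_eq hr, h, sub_self, mul_zero, add_zero]
  have h4 : (1 / 4 : ℂ) = ((1 / 4 : ℝ) : ℂ) := by norm_num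
  rw [h4, ← Complex.ofReal_add, ← Complex.ofReal_mul, Complex.ofReal_re]

lemma conj_complexHessian {r : C2 → ℝ} (hr : ContDiff ℝ ∞ r) (p X Y : C2) :
    starRingEnd ℂ (complexHessian r p X Y) = complexHessian r p Y X := by
  have h : ∀ A B, sndDeriv r p A B = sndDeriv r p B A := fun A B => fderiv_fderiv_comm hr p B A
  rw [complexHessian_eq hr, complexHessian_eq hr, h Y X, h (Complex.I • Y) (Complex.I • X),
    h Y (Complex.I • X), h (Complex.I • Y) X]
  simp only [map_mul, map_add, map_sub, Complex.conj_ofReal, Complex.conj_I, map_div₀, map_one,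
    map_ofNat]
  ring

lemma im_complexHessian_self {r : C2 → ℝ} (hr : ContDiff ℝ ∞ r) (p X : C2) :
    (complexHessian r p X X).im = 0 :=
  Complex.conj_eq_iff_im.1 (conj_complexHessian hr p X X)

lemma holDeriv_toComplex {r : C2 → ℝ} (hr : ContDiff ℝ ∞ r) (p X : C2) :
    holDeriv (toComplex r) p X =
      (1 / 2) * (fderiv ℝ r p X - Complex.I * fderiv ℝ r p (Complex.I • X)) := by
  rw [holDeriv_eq, fderiv_toComplex hr, fderiv_toComplex hr]

lemma isComplexTangent_iff {r : C2 → ℝ} (hr : ContDiff ℝ ∞ r) (p X : C2) :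
    IsComplexTangent r p X ↔ fderiv ℝ r p X = 0 ∧ fderiv ℝ r p (Complex.I • X) = 0 := by
  have h : IsComplexTangent r p X ↔ holDeriv (toComplex r) p X = 0 := Iff.rfl
  rw [h, holDeriv_toComplex hr]
  simp [Complex.ext_iff]

/-! ### Extension and germs -/

/-- Multiplication by a smooth cutoff. Since germs along `K` are kept, all derivatives there are
kept, and the calculus need only treat globally smooth functions. -/
lemma exists_contDiff_eventuallyEq {E : Type*} [NormedAddCommGroup E] [NormedSpace ℝ E]
    [FiniteDimensional ℝ E] {f : E → ℝ} {U K : Set E} (hU : IsOpen U) (hK : IsClosed K)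
    (hKU : K ⊆ U) (hf : ContDiffOn ℝ ∞ f U) :
    ∃ g : E → ℝ, ContDiff ℝ ∞ g ∧ ∀ x ∈ K, g =ᶠ[𝓝 x] f := by
  obtain ⟨χ, h0, h1, -⟩ := exists_contMDiffMap_zero_one_nhds_of_isClosed (n := ⊤)
    (modelWithCornersSelf ℝ E) hU.isClosed_compl hK
    (Set.disjoint_left.2 fun x hx hx' => hx (hKU hx'))
  refine ⟨fun x => χ x * f x, ?_, fun x hx => ?_⟩
  · have hχ : ContDiff ℝ ∞ χ := χ.contMDiff.contDiff
    rw [contDiff_iff_contDiffAt]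
    intro x
    by_cases hx : x ∈ U
    · exact hχ.contDiffAt.mul (hf.contDiffAt (hU.mem_nhds hx))
    · have : (fun x => χ x * f x) =ᶠ[𝓝 x] fun _ => 0 := by
        filter_upwards [h0.filter_mono (nhds_le_nhdsSet (show x ∈ Uᶜ from hx))] with y hy
        simp [hy]
      exact contDiffAt_const.congr_of_eventuallyEq this
  · filter_upwards [h1.filter_mono (nhds_le_nhdsSet hx)] with y hy
    simp [hy]

lemma wirt_congr_of_eventuallyEq {f g : C2 → ℂ} {p : C2} (h : f =ᶠ[𝓝 p] g) (j : Fin 2) :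
    wirt j f p = wirt j g p := by
  simp [wirt, h.fderiv_eq]

lemma wirtBar_congr_of_eventuallyEq {f g : C2 → ℂ} {p : C2} (h : f =ᶠ[𝓝 p] g) (j : Fin 2) :
    wirtBar j f =ᶠ[𝓝 p] wirtBar j g := by
  filter_upwards [h.fderiv (𝕜 := ℝ)] with q hq
  simp [wirtBar, hq]

lemma eventuallyEq_toComplex {f g : C2 → ℝ} {p : C2} (h : f =ᶠ[𝓝 p] g) :
    toComplex f =ᶠ[𝓝 p] toComplex g := by
  filter_upwards [h] with q hq
  simp [toComplex, hq]

lemma complexHessian_congr {f g : C2 → ℝ} {p : C2} (h : f =ᶠ[𝓝 p] g) :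
    complexHessian f p = complexHessian g p := by
  funext X Y
  unfold complexHessian
  refine Finset.sum_congr rfl fun j _ => Finset.sum_congr rfl fun k _ => ?_
  rw [wirt_congr_of_eventuallyEq (wirtBar_congr_of_eventuallyEq (eventuallyEq_toComplex h) k) j]

lemma wirt_congr {f g : C2 → ℝ} {p : C2} (h : f =ᶠ[𝓝 p] g) (j : Fin 2) :
    wirt j (toComplex f) p = wirt j (toComplex g) p :=
  wirt_congr_of_eventuallyEq (eventuallyEq_toComplex h) j

/-! ### The unnormalised tangential and normal fields -/

/-- The unnormalised tangential field `∂r/∂w ∂/∂z - ∂r/∂z ∂/∂w`. -/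
def tang (r : C2 → ℝ) (p : C2) : C2 := !₂[wirt 1 (toComplex r) p, -wirt 0 (toComplex r) p]

/-- The unnormalised normal field `∂r/∂z̄ ∂/∂z + ∂r/∂w̄ ∂/∂w`. -/
def nrm (r : C2 → ℝ) (p : C2) : C2 := !₂[wirtBar 0 (toComplex r) p, wirtBar 1 (toComplex r) p]

/-- `|∂r/∂z|² + |∂r/∂w|²`. -/
def gradSq (r : C2 → ℝ) (p : C2) : ℝ :=
  ‖wirt 0 (toComplex r) p‖ ^ 2 + ‖wirt 1 (toComplex r) p‖ ^ 2

/-- The Levi form on the unnormalised tangential field. -/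
def leviFn (r : C2 → ℝ) (p : C2) : ℂ := complexHessian r p (tang r p) (tang r p)

/-- The complex Hessian on the unnormalised normal and tangential fields. -/
def mixFn (r : C2 → ℝ) (p : C2) : ℂ := complexHessian r p (nrm r p) (tang r p)

lemma gradSq_eq {r : C2 → ℝ} (hr : ContDiff ℝ ∞ r) (p : C2) : (gradSq r p : ℂ) =
    wirt 0 (toComplex r) p * wirtBar 0 (toComplex r) p +
      wirt 1 (toComplex r) p * wirtBar 1 (toComplex r) p := by
  simp only [gradSq, ← conj_wirt_toComplex hr, Complex.mul_conj, Complex.normSq_eq_norm_sq]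
  push_cast; rfl

lemma gradSq_nonneg (r : C2 → ℝ) (p : C2) : 0 ≤ gradSq r p := by
  unfold gradSq; positivity

lemma holDeriv_two (f : C2 → ℂ) (p X : C2) :
    holDeriv f p X = wirt 0 f p * X 0 + wirt 1 f p * X 1 := by
  simp [holDeriv, Fin.sum_univ_two]

lemma complexHessian_two (r : C2 → ℝ) (p X Y : C2) : complexHessian r p X Y =
    wirt 0 (wirtBar 0 (toComplex r)) p * X 0 * starRingEnd ℂ (Y 0) +
    wirt 0 (wirtBar 1 (toComplex r)) p * X 0 * starRingEnd ℂ (Y 1) +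
    wirt 1 (wirtBar 0 (toComplex r)) p * X 1 * starRingEnd ℂ (Y 0) +
    wirt 1 (wirtBar 1 (toComplex r)) p * X 1 * starRingEnd ℂ (Y 1) := by
  simp [complexHessian, Fin.sum_univ_two]; ring

lemma holDeriv_lincomb (f : C2 → ℂ) (p X Y : C2) (a b : ℂ) :
    holDeriv f p (a • X + b • Y) = a * holDeriv f p X + b * holDeriv f p Y := by
  simp only [holDeriv_two, PiLp.add_apply, PiLp.smul_apply, smul_eq_mul]; ring

lemma complexHessian_lincomb (r : C2 → ℝ) (p X Y : C2) (a b : ℂ) :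
    complexHessian r p (a • X + b • Y) (a • X + b • Y) =
      a * starRingEnd ℂ a * complexHessian r p X X + b * starRingEnd ℂ b * complexHessian r p Y Y
      + a * starRingEnd ℂ b * complexHessian r p X Y
      + b * starRingEnd ℂ a * complexHessian r p Y X := by
  simp only [complexHessian_two, PiLp.add_apply, PiLp.smul_apply, smul_eq_mul, map_add, map_mul]
  ring

lemma complexHessian_smul (r : C2 → ℝ) (p X Y : C2) (a b : ℂ) :
    complexHessian r p (a • X) (b • Y) =
      a * starRingEnd ℂ b * complexHessian r p X Y := by
  simp only [complexHessian_two, PiLp.smul_apply, smul_eq_mul, map_mul]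
  ring

lemma holDeriv_tang_self (r : C2 → ℝ) (p : C2) : holDeriv (toComplex r) p (tang r p) = 0 := by
  simp only [holDeriv_two, tang]; simp; ring

lemma holDeriv_nrm_self {r : C2 → ℝ} (hr : ContDiff ℝ ∞ r) (p : C2) :
    holDeriv (toComplex r) p (nrm r p) = gradSq r p := by
  rw [gradSq_eq hr, holDeriv_two]; simp [nrm]

lemma leviFn_eq {r : C2 → ℝ} (hr : ContDiff ℝ ∞ r) : leviFn r = fun p =>
    wirt 0 (wirtBar 0 (toComplex r)) p * wirt 1 (toComplex r) p * wirtBar 1 (toComplex r) p -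
    wirt 0 (wirtBar 1 (toComplex r)) p * wirt 1 (toComplex r) p * wirtBar 0 (toComplex r) p -
    wirt 1 (wirtBar 0 (toComplex r)) p * wirt 0 (toComplex r) p * wirtBar 1 (toComplex r) p +
    wirt 1 (wirtBar 1 (toComplex r)) p * wirt 0 (toComplex r) p * wirtBar 0 (toComplex r) p := by
  funext p
  simp [leviFn, complexHessian_two, tang, conj_wirt_toComplex hr]; ring

lemma mixFn_eq {r : C2 → ℝ} (hr : ContDiff ℝ ∞ r) : mixFn r = fun p =>
    wirt 0 (wirtBar 0 (toComplex r)) p * wirtBar 0 (toComplex r) p * wirtBar 1 (toComplex r) p -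
    wirt 0 (wirtBar 1 (toComplex r)) p * wirtBar 0 (toComplex r) p * wirtBar 0 (toComplex r) p +
    wirt 1 (wirtBar 0 (toComplex r)) p * wirtBar 1 (toComplex r) p * wirtBar 1 (toComplex r) p -
    wirt 1 (wirtBar 1 (toComplex r)) p * wirtBar 1 (toComplex r) p * wirtBar 0 (toComplex r) p := by
  funext p
  simp [mixFn, complexHessian_two, tang, nrm, conj_wirt_toComplex hr]; ring

lemma contDiff_leviFn {r : C2 → ℝ} (hr : ContDiff ℝ ∞ r) : ContDiff ℝ ∞ (leviFn r) := by
  have hc := contDiff_toComplex hr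
  have ha := contDiff_wirt hc
  have hb := contDiff_wirtBar hc
  have hH := fun j k => contDiff_wirt (hb k) j
  rw [leviFn_eq hr]
  exact (((((hH 0 0).mul (ha 1)).mul (hb 1)).sub (((hH 0 1).mul (ha 1)).mul (hb 0))).sub
    (((hH 1 0).mul (ha 0)).mul (hb 1))).add (((hH 1 1).mul (ha 0)).mul (hb 0))

lemma contDiff_mixFn {r : C2 → ℝ} (hr : ContDiff ℝ ∞ r) : ContDiff ℝ ∞ (mixFn r) := by
  have hb := contDiff_wirtBar (contDiff_toComplex hr)
  have hH := fun j k => contDiff_wirt (hb k) j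
  rw [mixFn_eq hr]
  exact (((((hH 0 0).mul (hb 0)).mul (hb 1)).sub (((hH 0 1).mul (hb 0)).mul (hb 0))).add
    (((hH 1 0).mul (hb 1)).mul (hb 1))).sub (((hH 1 1).mul (hb 1)).mul (hb 0))

/-- Where the complex Hessian annihilates the tangential field, the normal derivative of the Levi
form is the tangential derivative of the mixed term. -/
lemma holDeriv_leviFn_nrm {r : C2 → ℝ} (hr : ContDiff ℝ ∞ r) {p : C2} (hs : gradSq r p ≠ 0)
    (hF : leviFn r p = 0) (hg : mixFn r p = 0) :
    holDeriv (leviFn r) p (nrm r p) = holDeriv (mixFn r) p (tang r p) := by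
  have hc := contDiff_toComplex hr
  have ha := fun j => differentiable_of_smooth (contDiff_wirt hc j)
  have hb := fun j => differentiable_of_smooth (contDiff_wirtBar hc j)
  have hH := fun j k => differentiable_of_smooth (contDiff_wirt (contDiff_wirtBar hc k) j)
  have hs' : (gradSq r p : ℂ) ≠ 0 := by exact_mod_cast hs
  rw [gradSq_eq hr] at hs'
  have hconj : ∀ j k, starRingEnd ℂ (wirt j (wirtBar k (toComplex r)) p) =
      wirt k (wirtBar j (toComplex r)) p := fun j k => by
    rw [← wirtBar_conj (differentiable_of_smooth (contDiff_wirtBar hc k)), wirt_wirtBar_comm hc k j]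
    simp_rw [conj_wirtBar_toComplex hr]
  have hF' := congrFun (leviFn_eq hr) p
  have hg' := congrFun (mixFn_eq hr) p
  rw [hF] at hF'
  rw [hg] at hg'
  -- With `w_j` the Hessian on `∂/∂z_j` and `L`, the scalars `F = a₁ w₀ - a₀ w₁` and `g = b₀ w₀ + b₁
  -- w₁` form a linear system of determinant `gradSq`. Hence `w₀ = w₁ = 0`: the tangential field
  -- lies in the kernel of the Hessian.
  have hw0 : wirt 0 (wirtBar 0 (toComplex r)) p * wirtBar 1 (toComplex r) p -
      wirt 0 (wirtBar 1 (toComplex r)) p * wirtBar 0 (toComplex r) p = 0 := by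
    apply (mul_eq_zero.1 _).resolve_left hs'
    linear_combination (-wirt 0 (toComplex r) p) * hg' - wirtBar 1 (toComplex r) p * hF'
  have hw1 : wirt 1 (wirtBar 0 (toComplex r)) p * wirtBar 1 (toComplex r) p -
      wirt 1 (wirtBar 1 (toComplex r)) p * wirtBar 0 (toComplex r) p = 0 := by
    apply (mul_eq_zero.1 _).resolve_left hs'
    linear_combination (-wirt 1 (toComplex r) p) * hg' + wirtBar 0 (toComplex r) p * hF'
  have hv0 := congrArg (starRingEnd ℂ) hw0
  have hv1 := congrArg (starRingEnd ℂ) hw1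
  simp only [map_sub, map_mul, map_zero, hconj, conj_wirtBar_toComplex hr] at hv0 hv1
  have hT : ∀ k, wirt 1 (wirt 0 (wirtBar k (toComplex r))) = wirt 0 (wirt 1 (wirtBar k (toComplex r)))
    := fun k => wirt_wirt_comm (contDiff_wirtBar hc k) 1 0
  have hA : wirt 1 (wirt 0 (toComplex r)) = wirt 0 (wirt 1 (toComplex r)) := wirt_wirt_comm hc 1 0
  rw [holDeriv_two, holDeriv_two, leviFn_eq hr, mixFn_eq hr]
  have ha0 := ha 0
  have ha1 := ha 1
  have hb0 := hb 0
  have hb1 := hb 1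
  have h00 := hH 0 0
  have h01 := hH 0 1
  have h10 := hH 1 0
  have h11 := hH 1 1
  simp (disch := fun_prop) only [wirt_add, wirt_sub, wirt_mul, hT, hA]
  simp only [tang, nrm]
  simp only [Matrix.cons_val_zero, Matrix.cons_val_one]
  generalize wirt 0 (wirt 1 (toComplex r)) p = A01
  generalize wirt 0 (wirt 0 (toComplex r)) p = A00
  generalize wirt 1 (wirt 1 (toComplex r)) p = A11
  generalize wirt 0 (wirt 0 (wirtBar 0 (toComplex r))) p = T000 at *
  generalize wirt 0 (wirt 0 (wirtBar 1 (toComplex r))) p = T001 at *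
  generalize wirt 0 (wirt 1 (wirtBar 0 (toComplex r))) p = T010 at *
  generalize wirt 0 (wirt 1 (wirtBar 1 (toComplex r))) p = T011 at *
  generalize wirt 1 (wirt 1 (wirtBar 0 (toComplex r))) p = T110 at *
  generalize wirt 1 (wirt 1 (wirtBar 1 (toComplex r))) p = T111 at *
  generalize wirt 0 (wirtBar 0 (toComplex r)) p = H00 at *
  generalize wirt 0 (wirtBar 1 (toComplex r)) p = H01 at *
  generalize wirt 1 (wirtBar 0 (toComplex r)) p = H10 at *
  generalize wirt 1 (wirtBar 1 (toComplex r)) p = H11 at *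
  generalize wirt 0 (toComplex r) p = a0 at *
  generalize wirt 1 (toComplex r) p = a1 at *
  generalize wirtBar 0 (toComplex r) p = b0 at *
  generalize wirtBar 1 (toComplex r) p = b1 at *
  -- The third-order terms of both sides agree by commutation of holomorphic derivatives. Every
  -- remaining term contains the Hessian paired with `L` in one of its two slots, hence a `w_j` or
  -- its conjugate.
  linear_combination (b0 * A01 + b1 * A11 - (a1 * H00 - a0 * H10)) * hw0
    + (-(b0 * A00 + b1 * A01) - (a1 * H01 - a0 * H11)) * hw1
    + (b0 * H01 + b1 * H11 + (H01 * b0 + H11 * b1)) * hv0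
    + (-(b0 * H00 + b1 * H10) - (H00 * b0 + H10 * b1)) * hv1

lemma toComplex_re_leviFn {r : C2 → ℝ} (hr : ContDiff ℝ ∞ r) :
    toComplex (fun q => (leviFn r q).re) = leviFn r := by
  funext q
  exact Complex.ext (by simp [toComplex]) (by simp [toComplex, leviFn, im_complexHessian_self hr])

lemma contDiff_re_leviFn {r : C2 → ℝ} (hr : ContDiff ℝ ∞ r) :
    ContDiff ℝ ∞ (fun q => (leviFn r q).re) :=
  Complex.reCLM.contDiff.comp (contDiff_leviFn hr)

lemma fderiv_eq_two_re_holDeriv {f : C2 → ℝ} (hf : ContDiff ℝ ∞ f) (p X : C2) :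
    fderiv ℝ f p X = 2 * (holDeriv (toComplex f) p X).re := by
  rw [holDeriv_toComplex hf]
  simp

lemma gradSq_pos_iff {r : C2 → ℝ} (hr : ContDiff ℝ ∞ r) (p : C2) :
    0 < gradSq r p ↔ fderiv ℝ r p ≠ 0 := by
  constructor
  · intro h h0
    have := fderiv_eq_two_re_holDeriv hr p (nrm r p)
    rw [holDeriv_nrm_self hr, h0] at this
    simp at this
    exact h.ne' this
  · intro h
    refine lt_of_le_of_ne (gradSq_nonneg r p) fun h0 => h ?_
    have h0' : wirt 0 (toComplex r) p = 0 ∧ wirt 1 (toComplex r) p = 0 := by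
      have h1 := sq_nonneg ‖wirt 0 (toComplex r) p‖
      have h2 := sq_nonneg ‖wirt 1 (toComplex r) p‖
      unfold gradSq at h0
      constructor
      · have : ‖wirt 0 (toComplex r) p‖ ^ 2 = 0 := by linarith
        simpa using this
      · have : ‖wirt 1 (toComplex r) p‖ ^ 2 = 0 := by linarith
        simpa using this
    ext X
    rw [fderiv_eq_two_re_holDeriv hr, holDeriv_two, h0'.1, h0'.2]
    simp

lemma exists_eq_lincomb_tang_nrm {r : C2 → ℝ} (hr : ContDiff ℝ ∞ r) {p : C2} (hs : 0 < gradSq r p)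
    (X : C2) : ∃ a b : ℂ, X = a • tang r p + b • nrm r p := by
  have hs' : (gradSq r p : ℂ) ≠ 0 := by exact_mod_cast hs.ne'
  have hS := gradSq_eq hr p
  generalize (gradSq r p : ℂ) = S at hs' hS
  refine ⟨(X 0 * wirtBar 1 (toComplex r) p - X 1 * wirtBar 0 (toComplex r) p) / S,
    (X 0 * wirt 0 (toComplex r) p + X 1 * wirt 1 (toComplex r) p) / S, ?_⟩
  ext i
  fin_cases i
  · simp only [tang, nrm, Fin.zero_eta, PiLp.add_apply, PiLp.smul_apply, Matrix.cons_val_zero,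
      smul_eq_mul]
    field_simp
    rw [hS]
    ring
  · simp only [tang, nrm, Fin.mk_one, PiLp.add_apply, PiLp.smul_apply, Matrix.cons_val_one,
      Matrix.cons_val_fin_one, smul_eq_mul]
    field_simp
    rw [hS]
    ring

lemma isComplexTangent_tang (r : C2 → ℝ) (p : C2) : IsComplexTangent r p (tang r p) :=
  holDeriv_tang_self r p

lemma exists_eq_smul_tang {r : C2 → ℝ} (hr : ContDiff ℝ ∞ r) {p : C2} (hs : 0 < gradSq r p)
    {X : C2} (hX : IsComplexTangent r p X) : ∃ a : ℂ, X = a • tang r p := by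
  obtain ⟨a, b, rfl⟩ := exists_eq_lincomb_tang_nrm hr hs X
  have h : holDeriv (toComplex r) p (a • tang r p + b • nrm r p) = 0 := hX
  rw [holDeriv_lincomb, holDeriv_tang_self, holDeriv_nrm_self hr] at h
  have hs' : (gradSq r p : ℂ) ≠ 0 := by exact_mod_cast hs.ne'
  have hb : b = 0 := by simpa [hs'] using h
  exact ⟨a, by simp [hb]⟩

lemma continuous_toComplex_wirt {r : C2 → ℝ} (hr : ContDiff ℝ ∞ r) (j : Fin 2) :
    Continuous (wirt j (toComplex r)) := (contDiff_wirt (contDiff_toComplex hr) j).continuous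

lemma continuous_toComplex_wirtBar {r : C2 → ℝ} (hr : ContDiff ℝ ∞ r) (j : Fin 2) :
    Continuous (wirtBar j (toComplex r)) := (contDiff_wirtBar (contDiff_toComplex hr) j).continuous

lemma continuous_complexHessian {r : C2 → ℝ} (hr : ContDiff ℝ ∞ r) {X Y : C2 → C2}
    (hX : Continuous X) (hY : Continuous Y) :
    Continuous fun p => complexHessian r p (X p) (Y p) := by
  have hH := fun j k => (contDiff_wirt (contDiff_wirtBar (contDiff_toComplex hr) k) j).continuous
  unfold complexHessian
  refine continuous_finsetSum _ fun j _ => continuous_finsetSum _ fun k _ => ?_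
  exact ((hH j k).mul ((EuclideanSpace.proj j).continuous.comp hX)).mul
    (Complex.continuous_conj.comp ((EuclideanSpace.proj k).continuous.comp hY))

lemma continuous_holDeriv {f : C2 → ℂ} (hf : ContDiff ℝ ∞ f) {X : C2 → C2}
    (hX : Continuous X) : Continuous fun p => holDeriv f p (X p) := by
  unfold holDeriv
  exact continuous_finsetSum _ fun j _ => (contDiff_wirt hf j).continuous.mul
    ((EuclideanSpace.proj j).continuous.comp hX)

lemma continuous_tang {r : C2 → ℝ} (hr : ContDiff ℝ ∞ r) : Continuous (tang r) := by
  refine (PiLp.continuous_toLp 2 _).comp (continuous_pi fun i => ?_)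
  fin_cases i
  · exact continuous_toComplex_wirt hr 1
  · exact (continuous_toComplex_wirt hr 0).neg

lemma continuous_nrm {r : C2 → ℝ} (hr : ContDiff ℝ ∞ r) : Continuous (nrm r) := by
  refine (PiLp.continuous_toLp 2 _).comp (continuous_pi fun i => ?_)
  fin_cases i
  · exact continuous_toComplex_wirtBar hr 0
  · exact continuous_toComplex_wirtBar hr 1

lemma continuous_gradSq {r : C2 → ℝ} (hr : ContDiff ℝ ∞ r) : Continuous (gradSq r) :=
  ((continuous_toComplex_wirt hr 0).norm.pow 2).add ((continuous_toComplex_wirt hr 1).norm.pow 2)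

/-! ### The form governing plurisubharmonicity near the boundary -/

/-- Completing the square after multiplication by `m * d`. The form is set up for a tangential entry
of order `d` and a normal entry of order `1 / d`, so that only `d * B` has to stay bounded. -/
lemma hermitian_form_nonneg {d m A B : ℝ} {a b T : ℂ} (hd : 0 < d) (hm : 0 < m) (hA : m * d ≤ A)
    (hT : ‖T‖ ^ 2 ≤ m * (d * B)) :
    0 ≤ ‖a‖ ^ 2 * A + 2 * (a * starRingEnd ℂ b * T).re + ‖b‖ ^ 2 * B := by
  have hre : -(‖a‖ * ‖b‖ * ‖T‖) ≤ (a * starRingEnd ℂ b * T).re := by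
    have h := (abs_le.1 (Complex.abs_re_le_norm (a * starRingEnd ℂ b * T))).1
    simpa [norm_mul] using h
  have hmd : 0 < m * d := mul_pos hm hd
  have h1 : ‖a‖ ^ 2 * (m * d) ≤ ‖a‖ ^ 2 * A := mul_le_mul_of_nonneg_left hA (sq_nonneg _)
  have h2 : ‖b‖ ^ 2 * ‖T‖ ^ 2 ≤ ‖b‖ ^ 2 * (m * (d * B)) :=
    mul_le_mul_of_nonneg_left hT (sq_nonneg _)
  refine nonneg_of_mul_nonneg_right (a := m * d) ?_ hmd
  have h3 := mul_le_mul_of_nonneg_left h1 hmd.le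
  have h4 := mul_le_mul_of_nonneg_left hre hmd.le
  nlinarith [sq_nonneg (m * d * ‖a‖ - ‖b‖ * ‖T‖)]

/-- The form whose nonnegativity at `q` says that `-(-r e^{-ψ})^τ` has nonnegative complex Hessian
at `q`, up to a positive factor. -/
def condForm (τ : ℝ) (r ψ : C2 → ℝ) (q X : C2) : ℝ :=
  (complexHessian r q X X).re + (-r q) * (complexHessian ψ q X X).re
    - τ * (-r q) * ‖holDeriv (toComplex ψ) q X‖ ^ 2
    - 2 * τ * (holDeriv (toComplex r) q X * starRingEnd ℂ (holDeriv (toComplex ψ) q X)).re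
    + (1 - τ) / (-r q) * ‖holDeriv (toComplex r) q X‖ ^ 2

lemma re_complexHessian_lincomb {r : C2 → ℝ} (hr : ContDiff ℝ ∞ r) (p X Y : C2) (a b : ℂ) :
    (complexHessian r p (a • X + b • Y) (a • X + b • Y)).re =
      ‖a‖ ^ 2 * (complexHessian r p X X).re + ‖b‖ ^ 2 * (complexHessian r p Y Y).re
      + 2 * (a * starRingEnd ℂ b * complexHessian r p X Y).re := by
  rw [complexHessian_lincomb, ← conj_complexHessian hr p X Y]
  simp only [Complex.add_re, Complex.mul_re, Complex.conj_re, Complex.conj_im, Complex.mul_im,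
    Complex.sq_norm, Complex.normSq_apply, im_complexHessian_self hr]
  ring

/-- The part of the tangential coefficient of `condForm` that is linear in the boundary distance. -/
def tangCoeff (τ : ℝ) (r ψ : C2 → ℝ) (q : C2) : ℝ :=
  (complexHessian ψ q (tang r q) (tang r q)).re - τ * ‖holDeriv (toComplex ψ) q (tang r q)‖ ^ 2

/-- The off-diagonal coefficient of `condForm`. -/
def crossCoeff (τ : ℝ) (r ψ : C2 → ℝ) (q : C2) : ℂ :=
  complexHessian r q (tang r q) (nrm r q)
    + ((-r q : ℝ) : ℂ) * complexHessian ψ q (tang r q) (nrm r q)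
    - ((τ * (-r q) : ℝ) : ℂ) * (holDeriv (toComplex ψ) q (tang r q) *
      starRingEnd ℂ (holDeriv (toComplex ψ) q (nrm r q)))
    - ((τ * gradSq r q : ℝ) : ℂ) * holDeriv (toComplex ψ) q (tang r q)

/-- The normal coefficient of `condForm`, multiplied by the boundary distance. -/
def nrmCoeff (τ : ℝ) (r ψ : C2 → ℝ) (q : C2) : ℝ :=
  (-r q) * ((complexHessian r q (nrm r q) (nrm r q)).re
    + (-r q) * (complexHessian ψ q (nrm r q) (nrm r q)).re
    - τ * (-r q) * ‖holDeriv (toComplex ψ) q (nrm r q)‖ ^ 2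
    - 2 * τ * gradSq r q * (holDeriv (toComplex ψ) q (nrm r q)).re)
    + (1 - τ) * gradSq r q ^ 2

/-- `∂r` annihilates `tang`, so the singular term `(1 - τ) / (-r) * |∂r(X)|²` enters only the
coefficient of `‖b‖ ^ 2`. -/
lemma condForm_lincomb {r ψ : C2 → ℝ} (hr : ContDiff ℝ ∞ r) (hψ : ContDiff ℝ ∞ ψ) (τ : ℝ)
    {q : C2} (hq : r q < 0) (a b : ℂ) :
    condForm τ r ψ q (a • tang r q + b • nrm r q) =
      ‖a‖ ^ 2 * ((leviFn r q).re + (-r q) * tangCoeff τ r ψ q)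
      + 2 * (a * starRingEnd ℂ b * crossCoeff τ r ψ q).re
      + ‖b‖ ^ 2 * (nrmCoeff τ r ψ q / (-r q)) := by
  have hd : -r q ≠ 0 := by linarith
  unfold condForm tangCoeff crossCoeff nrmCoeff leviFn
  rw [re_complexHessian_lincomb hr, re_complexHessian_lincomb hψ, holDeriv_lincomb,
    holDeriv_lincomb, holDeriv_tang_self, holDeriv_nrm_self hr]
  generalize holDeriv (toComplex ψ) q (tang r q) = U
  generalize holDeriv (toComplex ψ) q (nrm r q) = V
  generalize complexHessian r q (tang r q) (nrm r q) = H
  generalize complexHessian ψ q (tang r q) (nrm r q) = K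
  generalize -r q = d at hd
  have hn : ∀ z : ℂ, ‖z‖ ^ 2 = z.re * z.re + z.im * z.im := fun z => by
    rw [Complex.sq_norm, Complex.normSq_apply]
  simp only [hn, Complex.add_re, Complex.sub_re, Complex.mul_re, Complex.conj_re, Complex.conj_im,
    Complex.mul_im, Complex.add_im, Complex.sub_im, Complex.ofReal_re, Complex.ofReal_im,
    Complex.zero_re, Complex.zero_im]
  field_simp
  ring

lemma continuous_tangCoeff {r ψ : C2 → ℝ} (hr : ContDiff ℝ ∞ r) (hψ : ContDiff ℝ ∞ ψ) (τ : ℝ) :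
    Continuous (tangCoeff τ r ψ) := by
  have hL := continuous_tang hr
  have h1 := continuous_complexHessian hψ hL hL
  have h2 := continuous_holDeriv (contDiff_toComplex hψ) hL
  unfold tangCoeff
  exact (Complex.continuous_re.comp h1).sub (continuous_const.mul (h2.norm.pow 2))

lemma continuous_crossCoeff {r ψ : C2 → ℝ} (hr : ContDiff ℝ ∞ r) (hψ : ContDiff ℝ ∞ ψ) (τ : ℝ) :
    Continuous (crossCoeff τ r ψ) := by
  have hL := continuous_tang hr
  have hN := continuous_nrm hr
  have hc := hr.continuous
  have hs := continuous_gradSq hr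
  have h1 := continuous_complexHessian hr hL hN
  have h2 := continuous_complexHessian hψ hL hN
  have h3 := continuous_holDeriv (contDiff_toComplex hψ) hL
  have h4 := continuous_holDeriv (contDiff_toComplex hψ) hN
  unfold crossCoeff
  fun_prop

lemma continuous_nrmCoeff {r ψ : C2 → ℝ} (hr : ContDiff ℝ ∞ r) (hψ : ContDiff ℝ ∞ ψ) (τ : ℝ) :
    Continuous (nrmCoeff τ r ψ) := by
  have hN := continuous_nrm hr
  have hc := hr.continuous
  have hs := continuous_gradSq hr
  have h1 := continuous_complexHessian hr hN hN
  have h2 := continuous_complexHessian hψ hN hN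
  have h4 := continuous_holDeriv (contDiff_toComplex hψ) hN
  unfold nrmCoeff
  fun_prop

/-- After the powers of `-r` are factored out, the three coefficients are continuous up to the
boundary, so the strict inequalities at `p` persist nearby. -/
lemma condForm_nonneg_near {r ψ : C2 → ℝ} (hr : ContDiff ℝ ∞ r) (hψ : ContDiff ℝ ∞ ψ)
    {τ l : ℝ} {p : C2} (hp : r p = 0) (hs : 0 < gradSq r p)
    (hl : ∀ᶠ q in 𝓝 p, r q < 0 → l * (-r q) ≤ (leviFn r q).re)
    (hpos : 0 < l + tangCoeff τ r ψ p)
    (hdet : ‖crossCoeff τ r ψ p‖ ^ 2 < (l + tangCoeff τ r ψ p) * ((1 - τ) * gradSq r p ^ 2)) :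
    ∀ᶠ q in 𝓝 p, r q < 0 → ∀ X, 0 ≤ condForm τ r ψ q X := by
  have hP := continuous_tangCoeff hr hψ τ
  have hT := continuous_crossCoeff hr hψ τ
  have hS := continuous_nrmCoeff hr hψ τ
  have hSp : nrmCoeff τ r ψ p = (1 - τ) * gradSq r p ^ 2 := by simp [nrmCoeff, hp]
  rw [← hSp] at hdet
  have e1 : ∀ᶠ q in 𝓝 p, 0 < l + tangCoeff τ r ψ q :=
    (continuous_const.add hP).continuousAt.eventually (lt_mem_nhds hpos)
  have e2 : ∀ᶠ q in 𝓝 p, ‖crossCoeff τ r ψ q‖ ^ 2 <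
      (l + tangCoeff τ r ψ q) * nrmCoeff τ r ψ q :=
    (hT.norm.pow 2).continuousAt.eventually_lt
      ((continuous_const.add hP).mul hS).continuousAt hdet
  have e3 : ∀ᶠ q in 𝓝 p, 0 < gradSq r q :=
    (continuous_gradSq hr).continuousAt.eventually (lt_mem_nhds hs)
  filter_upwards [hl, e1, e2, e3] with q h0 h1 h2 h3 hq X
  obtain ⟨a, b, rfl⟩ := exists_eq_lincomb_tang_nrm hr h3 X
  have hd : 0 < -r q := by linarith
  rw [condForm_lincomb hr hψ τ hq]
  refine hermitian_form_nonneg hd h1 ?_ ?_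
  · have := h0 hq
    linarith
  · rw [mul_div_cancel₀ _ hd.ne']
    exact h2.le

/-! ### Lower bound of the Levi form near the boundary -/

lemma exists_mem_segment_frontier {E : Type*} [NormedAddCommGroup E] [NormedSpace ℝ E] {Ω : Set E}
    {q ν : E} {t₀ : ℝ} (ht : 0 ≤ t₀) (hq : q ∈ Ω) (hq' : q + t₀ • ν ∉ Ω) :
    ∃ t ∈ Set.Icc 0 t₀, q + t • ν ∈ frontier Ω := by
  -- Otherwise the interiors of `Ω` and of its complement would disconnect the segment.
  by_contra! h
  have hpre : IsPreconnected ((fun t : ℝ => q + t • ν) '' Set.Icc 0 t₀) :=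
    isPreconnected_Icc.image _ (by fun_prop)
  have hcov : (fun t : ℝ => q + t • ν) '' Set.Icc 0 t₀ ⊆ interior Ω ∪ interior Ωᶜ := by
    rintro _ ⟨t, ht1, rfl⟩
    rw [← compl_frontier_eq_union_interior]
    exact h t ht1
  have h0 : q ∈ (fun t : ℝ => q + t • ν) '' Set.Icc 0 t₀ := ⟨0, ⟨le_rfl, ht⟩, by simp⟩
  have h1 : q + t₀ • ν ∈ (fun t : ℝ => q + t • ν) '' Set.Icc 0 t₀ := ⟨t₀, ⟨ht, le_rfl⟩, rfl⟩
  obtain ⟨x, -, hx1, hx2⟩ := hpre _ _ isOpen_interior isOpen_interior hcov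
    ⟨q, h0, (hcov h0).resolve_right fun h => interior_subset h hq⟩
    ⟨_, h1, (hcov h1).resolve_left fun h => hq' (interior_subset h)⟩
  exact interior_subset hx2 (interior_subset hx1)

/-- If `F` is nonnegative on the boundary of `Ω` and `F + l r` decreases in a direction that leaves
`Ω`, then `F ≥ l (-r)` in `Ω` near the boundary point. -/
lemma le_of_nonneg_on_frontier {E : Type*} [NormedAddCommGroup E] [NormedSpace ℝ E] {Ω U : Set E}
    {F r : E → ℝ} (hF : ContDiff ℝ ∞ F) (hr : ContDiff ℝ ∞ r) (hU : IsOpen U)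
    (hΩ : ∀ z ∈ U, z ∈ Ω ↔ r z < 0)
    {p ν : E} {l : ℝ} (hpU : p ∈ U) (hp : r p = 0)
    (hfr : ∀ z ∈ frontier Ω, r z = 0 ∧ 0 ≤ F z)
    (hν : 0 < fderiv ℝ r p ν) (hdec : fderiv ℝ F p ν + l * fderiv ℝ r p ν < 0) :
    ∀ᶠ q in 𝓝 p, r q < 0 → l * (-r q) ≤ F q := by
  have hFd := differentiable_of_smooth hF
  have hrd := differentiable_of_smooth hr
  have hcont : Continuous fun z => fderiv ℝ F z ν + l * fderiv ℝ r z ν :=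
    (contDiff_fderiv_apply_const hF ν).continuous.add
      (continuous_const.mul (contDiff_fderiv_apply_const hr ν).continuous)
  have e1 : ∀ᶠ z in 𝓝 p, fderiv ℝ F z ν + l * fderiv ℝ r z ν < 0 ∧ z ∈ U :=
    (hcont.continuousAt.eventually (gt_mem_nhds hdec)).and (hU.mem_nhds hpU)
  obtain ⟨ε, hε, hball⟩ := Metric.eventually_nhds_iff_ball.1 e1
  have hline : ∀ (f : E → ℝ), Differentiable ℝ f → ∀ (q : E) (t : ℝ),
      HasDerivAt (fun t : ℝ => f (q + t • ν)) (fderiv ℝ f (q + t • ν) ν) t := fun f hf q t => by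
    have h1 : HasDerivAt (fun t : ℝ => q + t • ν) ν t := by
      simpa using ((hasDerivAt_id t).smul_const ν).const_add q
    exact (hf _).hasFDerivAt.comp_hasDerivAt t h1
  -- a small step along `ν` leaves the domain
  have e2 : ∀ᶠ t in 𝓝[>] (0 : ℝ), 0 < r (p + t • ν) ∧ t * ‖ν‖ < ε / 2 := by
    have hd := hline r hrd p 0
    simp only [zero_smul, add_zero] at hd
    have hslope := hasDerivAt_iff_tendsto_slope.1 hd
    have h1 := (hslope.mono_left (nhdsWithin_mono 0 (fun x hx => (ne_of_gt hx))) :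
      Tendsto _ (𝓝[>] (0 : ℝ)) _).eventually (lt_mem_nhds hν)
    have h2 : ∀ᶠ t in 𝓝 (0 : ℝ), t * ‖ν‖ < ε / 2 := by
      have : Continuous fun t : ℝ => t * ‖ν‖ := by fun_prop
      exact this.continuousAt.eventually (gt_mem_nhds (by simpa using by positivity))
    filter_upwards [h1, self_mem_nhdsWithin, nhdsWithin_le_nhds h2] with t ht ht0 ht2
    refine ⟨?_, ht2⟩
    simp only [slope, vsub_eq_sub, smul_eq_mul, sub_zero, zero_smul, add_zero, hp] at ht
    exact pos_of_mul_pos_right ht (inv_nonneg.2 (le_of_lt ht0))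
  obtain ⟨t₀, ⟨ht1, ht2⟩, ht0⟩ := (e2.and self_mem_nhdsWithin).exists
  have ht0 : 0 < t₀ := ht0
  have e3 : ∀ᶠ q in 𝓝 p, 0 < r (q + t₀ • ν) := by
    have : Continuous fun q => r (q + t₀ • ν) := hr.continuous.comp (by fun_prop)
    exact this.continuousAt.eventually (lt_mem_nhds ht1)
  have e4 : ∀ᶠ q in 𝓝 p, q ∈ Metric.ball p (ε / 2) := Metric.ball_mem_nhds p (by positivity)
  filter_upwards [e3, e4] with q h3 h4 hq
  have hmem : ∀ t ∈ Set.Icc 0 t₀, q + t • ν ∈ Metric.ball p ε := fun t ht => by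
    rw [Metric.mem_ball, dist_eq_norm] at h4 ⊢
    calc ‖q + t • ν - p‖ = ‖(q - p) + t • ν‖ := by congr 1; abel
      _ ≤ ‖q - p‖ + ‖t • ν‖ := norm_add_le _ _
      _ = ‖q - p‖ + t * ‖ν‖ := by rw [norm_smul, Real.norm_of_nonneg ht.1]
      _ ≤ ‖q - p‖ + t₀ * ‖ν‖ := by gcongr; exact ht.2
      _ < ε := by linarith
  have h0 : q ∈ U := by
    have := (hball _ (hmem 0 ⟨le_rfl, ht0.le⟩)).2
    simpa using this
  have hqΩ : q ∈ Ω := (hΩ q h0).2 hq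
  have hq' : q + t₀ • ν ∉ Ω := fun h =>
    absurd ((hΩ _ (hball _ (hmem t₀ ⟨ht0.le, le_rfl⟩)).2).1 h) (not_lt.2 h3.le)
  obtain ⟨t, ht, hfront⟩ := exists_mem_segment_frontier ht0.le hqΩ hq'
  -- Along the segment from `q` to the frontier point, `F + l r` decreases to a value `≥ 0`, because
  -- there `r = 0` and `F ≥ 0`.
  have hanti : AntitoneOn (fun t : ℝ => F (q + t • ν) + l * r (q + t • ν)) (Set.Icc 0 t₀) := by
    refine antitoneOn_of_hasDerivWithinAt_nonpos (convex_Icc 0 t₀) ?_ (fun x hx =>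
      ((hline F hFd q x).add ((hline r hrd q x).const_mul l)).hasDerivWithinAt) ?_
    · exact fun x _ =>
        ((hline F hFd q x).add ((hline r hrd q x).const_mul l)).continuousAt.continuousWithinAt
    · intro x hx
      exact (hball _ (hmem x (interior_subset hx))).1.le
  have := hanti ⟨le_rfl, ht0.le⟩ ht ht.1
  simp only [zero_smul, add_zero] at this
  obtain ⟨g1, g2⟩ := hfr _ hfront
  rw [g1] at this
  linarith

/-! ### The weight -/

lemma contDiff_coord (j : Fin 2) : ContDiff ℝ ∞ (fun q : C2 => q j) :=
  ((EuclideanSpace.proj j : C2 →L[ℂ] ℂ).restrictScalars ℝ).contDiff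

lemma fderiv_coord (j : Fin 2) (p v : C2) : fderiv ℝ (fun q : C2 => q j) p v = v j := by
  have h : (fun q : C2 => q j) = ((EuclideanSpace.proj j : C2 →L[ℂ] ℂ).restrictScalars ℝ) := rfl
  rw [h, ContinuousLinearMap.fderiv]
  rfl

lemma wirt_coord (j k : Fin 2) (p : C2) :
    wirt k (fun q : C2 => q j) p = if j = k then 1 else 0 := by
  simp only [wirt, fderiv_coord]
  by_cases h : j = k
  · subst h; simp; norm_num
  · simp [h]

lemma wirtBar_coord (j k : Fin 2) (p : C2) : wirtBar k (fun q : C2 => q j) p = 0 := by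
  simp only [wirtBar, fderiv_coord]
  by_cases h : j = k
  · subst h; simp
  · simp [h]

/-- The weight `M |g|² + κ |z|²`. -/
def weight (g : C2 → ℂ) (M κ : ℝ) (q : C2) : ℝ := M * ‖g q‖ ^ 2 + κ * ‖q‖ ^ 2

lemma contDiff_weight {g : C2 → ℂ} (hg : ContDiff ℝ ∞ g) (M κ : ℝ) :
    ContDiff ℝ ∞ (weight g M κ) :=
  (contDiff_const.mul (hg.norm_sq ℝ)).add (contDiff_const.mul (contDiff_id.norm_sq ℝ))

lemma toComplex_weight (g : C2 → ℂ) (M κ : ℝ) : toComplex (weight g M κ) = fun q =>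
    (M : ℂ) * (g q * starRingEnd ℂ (g q)) +
      (κ : ℂ) * (q 0 * starRingEnd ℂ (q 0) + q 1 * starRingEnd ℂ (q 1)) := by
  funext q
  simp only [toComplex, weight, Complex.mul_conj, Complex.normSq_eq_norm_sq, EuclideanSpace.norm_sq_eq,
    Fin.sum_univ_two]
  push_cast
  ring

lemma wirtBar_weight {g : C2 → ℂ} (hg : ContDiff ℝ ∞ g) (M κ : ℝ) (k : Fin 2) :
    wirtBar k (toComplex (weight g M κ)) = fun q =>
      (M : ℂ) * (wirtBar k g q * starRingEnd ℂ (g q) + g q * starRingEnd ℂ (wirt k g q))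
        + (κ : ℂ) * q k := by
  funext q
  have h1 := differentiable_of_smooth hg
  have h2 := differentiable_of_smooth (contDiff_conj hg)
  have h3 := fun j => differentiable_of_smooth (contDiff_coord j)
  have h4 := fun j => differentiable_of_smooth (contDiff_conj (contDiff_coord j))
  have h30 := h3 0
  have h31 := h3 1
  have h40 := h4 0
  have h41 := h4 1
  rw [toComplex_weight]
  simp (disch := fun_prop) only [wirtBar_add, wirtBar_mul, wirtBar_const, wirtBar_conj h1,
    wirtBar_conj (h3 0), wirtBar_conj (h3 1), wirtBar_coord, wirt_coord]
  fin_cases k <;> simp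

lemma wirt_weight_of_eq_zero {g : C2 → ℂ} (hg : ContDiff ℝ ∞ g) (M κ : ℝ) (k : Fin 2) {p : C2}
    (hp : g p = 0) : wirt k (toComplex (weight g M κ)) p = (κ : ℂ) * starRingEnd ℂ (p k) := by
  rw [← conj_wirtBar_toComplex (contDiff_weight hg M κ), wirtBar_weight hg]
  simp [hp]

lemma wirt_wirtBar_weight_of_eq_zero {g : C2 → ℂ} (hg : ContDiff ℝ ∞ g) (M κ : ℝ) (j k : Fin 2)
    {p : C2} (hp : g p = 0) : wirt j (wirtBar k (toComplex (weight g M κ))) p =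
      (M : ℂ) * (wirtBar k g p * starRingEnd ℂ (wirtBar j g p)
        + wirt j g p * starRingEnd ℂ (wirt k g p)) + if k = j then (κ : ℂ) else 0 := by
  have h1 := differentiable_of_smooth hg
  have h2 := differentiable_of_smooth (contDiff_conj hg)
  have h3 := differentiable_of_smooth (contDiff_coord k)
  have h4 := differentiable_of_smooth (contDiff_wirtBar hg k)
  have h5 := differentiable_of_smooth (contDiff_conj (contDiff_wirt hg k))
  rw [wirtBar_weight hg]
  simp (disch := fun_prop) only [wirt_add, wirt_mul, wirt_const, wirt_conj h1, wirt_coord, hp]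
  by_cases h : k = j <;> simp [h]

lemma norm_sq_tang (r : C2 → ℝ) (p : C2) : ‖tang r p‖ ^ 2 = gradSq r p := by
  simp [EuclideanSpace.norm_sq_eq, Fin.sum_univ_two, tang, gradSq, add_comm]

/-- `M |g|²` vanishes to second order where `g = 0`, so the bound does not involve `M`. This is what
lets `M` be chosen after `κ`. -/
lemma holDeriv_weight_of_eq_zero {g : C2 → ℂ} (hg : ContDiff ℝ ∞ g) {M κ R : ℝ} {p X : C2}
    (hp : g p = 0) (hR : ‖p‖ ≤ R) :
    ‖holDeriv (toComplex (weight g M κ)) p X‖ ^ 2 ≤ κ ^ 2 * R ^ 2 * ‖X‖ ^ 2 := by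
  have h : holDeriv (toComplex (weight g M κ)) p X = κ * inner ℂ p X := by
    rw [holDeriv_two, wirt_weight_of_eq_zero hg M κ 0 hp, wirt_weight_of_eq_zero hg M κ 1 hp,
      PiLp.inner_apply, Fin.sum_univ_two]
    simp [mul_comm]
    ring
  have h2 : ‖inner ℂ p X‖ ≤ R * ‖X‖ :=
    (norm_inner_le_norm p X).trans (mul_le_mul_of_nonneg_right hR (norm_nonneg _))
  rw [h, norm_mul, mul_pow, Complex.norm_real, Real.norm_eq_abs, sq_abs, mul_assoc]
  refine mul_le_mul_of_nonneg_left ?_ (sq_nonneg κ)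
  rw [← mul_pow]
  exact pow_le_pow_left₀ (norm_nonneg _) h2 2

/-- At a zero of `g` the Hessian of `|g|²` is `|∂g|²` plus a square from `∂̄g`; the latter is
dropped. -/
lemma re_complexHessian_weight_of_eq_zero {g : C2 → ℂ} (hg : ContDiff ℝ ∞ g) {M κ : ℝ} (hM : 0 ≤ M)
    {p X : C2} (hp : g p = 0) :
    M * ‖holDeriv g p X‖ ^ 2 + κ * ‖X‖ ^ 2 ≤ (complexHessian (weight g M κ) p X X).re := by
  have h : complexHessian (weight g M κ) p X X =
      ((M * ‖starRingEnd ℂ (wirtBar 0 g p) * X 0 + starRingEnd ℂ (wirtBar 1 g p) * X 1‖ ^ 2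
        + (M * ‖holDeriv g p X‖ ^ 2 + κ * ‖X‖ ^ 2) : ℝ) : ℂ) := by
    have hn : ∀ z : ℂ, (‖z‖ : ℂ) ^ 2 = z * starRingEnd ℂ z := fun z => by
      rw [Complex.mul_conj, Complex.normSq_eq_norm_sq]; push_cast; rfl
    rw [EuclideanSpace.norm_sq_eq, Fin.sum_univ_two, complexHessian_two, holDeriv_two]
    simp only [wirt_wirtBar_weight_of_eq_zero hg M κ _ _ hp]
    push_cast
    simp only [hn, map_add, map_mul, Complex.conj_conj]
    simp
    ring
  rw [h, Complex.ofReal_re]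
  have := mul_nonneg hM (sq_nonneg
    ‖starRingEnd ℂ (wirtBar 0 g p) * X 0 + starRingEnd ℂ (wirtBar 1 g p) * X 1‖)
  linarith

/-- A smooth weight makes `condForm` nonnegative near the boundary. -/
lemma exists_weight_condForm_nonneg {Ω U : Set C2} {r : C2 → ℝ} (hr : ContDiff ℝ ∞ r)
    (hbdd : Bornology.IsBounded Ω) (hU : IsOpen U) (hcl : closure Ω ⊆ U)
    (hΩ : ∀ z ∈ U, z ∈ Ω ↔ r z < 0) (hzero : ∀ p ∈ frontier Ω, r p = 0)
    (hgrad : ∀ p ∈ frontier Ω, fderiv ℝ r p ≠ 0)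
    (hlevi : ∀ p ∈ frontier Ω, 0 ≤ (leviFn r p).re)
    (hmix : ∀ p ∈ frontier Ω, leviFn r p = 0 → mixFn r p = 0)
    {τ : ℝ} (hτ0 : 0 < τ) (hτ1 : τ < 1) :
    ∃ ψ : C2 → ℝ, ContDiff ℝ ∞ ψ ∧ ∀ p ∈ frontier Ω, ∀ᶠ q in 𝓝 p, r q < 0 →
      ∀ X, 0 ≤ condForm τ r ψ q X := by
  have hcpt : IsCompact (frontier Ω) :=
    hbdd.isCompact_closure.of_isClosed_subset isClosed_frontier frontier_subset_closure
  have hspos : ∀ p ∈ frontier Ω, 0 < gradSq r p := fun p hp => (gradSq_pos_iff hr p).2 (hgrad p hp)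
  obtain ⟨s₀, hs₀, hs₀le⟩ : ∃ s₀ : ℝ, 0 < s₀ ∧ ∀ p ∈ frontier Ω, s₀ ≤ gradSq r p := by
    rcases (frontier Ω).eq_empty_or_nonempty with h | h
    · exact ⟨1, one_pos, by simp [h]⟩
    · obtain ⟨x, hx, hmin⟩ := hcpt.exists_isMinOn h (continuous_gradSq hr).continuousOn
      exact ⟨gradSq r x, hspos x hx, fun p hp => hmin hp⟩
  obtain ⟨R, hR0, hR⟩ : ∃ R : ℝ, 0 < R ∧ ∀ p ∈ frontier Ω, ‖p‖ ≤ R := by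
    obtain ⟨R, hR⟩ := hcpt.isBounded.exists_norm_le
    exact ⟨max R 1, by positivity, fun p hp => (hR p hp).trans (le_max_left _ _)⟩
  have hτ' : 0 < 1 - τ := by linarith
  -- With `D = |Lψ|²`, at most `D` is lost in `tangCoeff` and `D / (1 - τ)` to the determinant, `c *
  -- D` in all. The choice of `κ` makes this at most `κ s / 2`.
  set c : ℝ := 1 + 1 / (1 - τ) with hc
  have hc0 : 0 < c := by positivity
  set κ : ℝ := 1 / (2 * R ^ 2 * c) with hκ
  have hκ0 : 0 < κ := by positivity
  have hκc : κ * R ^ 2 * c = 1 / 2 := by rw [hκ]; field_simp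
  -- Chosen so that `M |Lg|²` and the other half of `κ s` outweigh `|Lg| / s`, uniformly for `s ≥
  -- s₀`.
  set M : ℝ := 1 / (κ * s₀ ^ 3) with hM
  have hM0 : 0 < M := by positivity
  have hMs : M * κ * s₀ ^ 3 = 1 := by rw [hM]; field_simp
  have hψ := contDiff_weight (contDiff_mixFn hr) M κ
  refine ⟨weight (mixFn r) M κ, hψ, fun p hp => ?_⟩
  have hs := hspos p hp
  have hpU : p ∈ U := hcl (frontier_subset_closure hp)
  by_cases hF : leviFn r p = 0
  · have hg := hmix p hp hF
    have hNF := holDeriv_leviFn_nrm hr hs.ne' hF hg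
    set x : ℝ := ‖holDeriv (mixFn r) p (tang r p)‖ with hx
    set s := gradSq r p with hsdef
    have hs0s : s₀ ≤ s := hs₀le p hp
    have hH := re_complexHessian_weight_of_eq_zero (contDiff_mixFn hr) (κ := κ) hM0.le
      (X := tang r p) hg
    have hD := holDeriv_weight_of_eq_zero (contDiff_mixFn hr) (M := M) (κ := κ)
      (X := tang r p) hg (hR p hp)
    rw [norm_sq_tang, ← hsdef] at hH hD
    rw [← hx] at hH
    set D := ‖holDeriv (toComplex (weight (mixFn r) M κ)) p (tang r p)‖ ^ 2 with hDdef
    have hD0 : 0 ≤ D := sq_nonneg _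
    have hDc : D * c ≤ κ * s / 2 := by
      calc D * c ≤ κ ^ 2 * R ^ 2 * s * c := by gcongr
        _ = (κ * R ^ 2 * c) * (κ * s) := by ring
        _ = κ * s / 2 := by rw [hκc]; ring
    -- Complete the square in `x`: the minimum over `x` is positive exactly when `2 M κ s³ > 1`.
    have hmain : 0 < M * x ^ 2 - x / s + κ * s / 2 := by
      have h1 : 1 ≤ M * κ * s ^ 3 := by rw [← hMs]; gcongr
      have h2 : 0 < 4 * M * s ^ 2 * (M * x ^ 2 - x / s + κ * s / 2) := by
        have : 4 * M * s ^ 2 * (M * x ^ 2 - x / s + κ * s / 2) =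
          (2 * M * s * x - 1) ^ 2 + (2 * (M * κ * s ^ 3) - 1) := by field_simp; ring
        rw [this]
        nlinarith [sq_nonneg (2 * M * s * x - 1)]
      exact pos_of_mul_pos_right h2 (by positivity)
    set δ := (M * x ^ 2 - x / s + κ * s / 2) / 2 with hδ
    have hδ0 : 0 < δ := by positivity
    have hre : (holDeriv (leviFn r) p (nrm r p)).re ≤ x := by
      rw [hNF]; exact Complex.re_le_norm _
    -- `F` can grow along the outward field `N` at rate at most `2x`, while `r` grows at rate `2s`;
    -- the extra `δ`, half of the surplus in `hmain`, makes the decrease strict.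
    refine condForm_nonneg_near hr hψ (l := -(x / s) - δ) (hzero p hp) hs ?_ ?_ ?_
    · refine le_of_nonneg_on_frontier (ν := nrm r p) (Ω := Ω) (contDiff_re_leviFn hr) hr hU hΩ hpU
        (hzero p hp) (fun z hz => ⟨hzero z hz, hlevi z hz⟩) ?_ ?_
      · rw [fderiv_eq_two_re_holDeriv hr, holDeriv_nrm_self hr, Complex.ofReal_re]
        positivity
      · rw [fderiv_eq_two_re_holDeriv (contDiff_re_leviFn hr), toComplex_re_leviFn hr,
          fderiv_eq_two_re_holDeriv hr, holDeriv_nrm_self hr, Complex.ofReal_re, ← hsdef]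
        have : x / s * s = x := by field_simp
        nlinarith [mul_pos hδ0 hs]
    · have hτD : τ * D ≤ D := by nlinarith
      have h1c : D ≤ D * c := by
        have : 1 ≤ c := by rw [hc]; linarith [show 0 < 1 / (1 - τ) by positivity]
        nlinarith
      unfold tangCoeff
      rw [← hDdef]
      linarith
    -- On the boundary the terms with a factor `-r` vanish, and so does the Hessian of `r` on `L`
    -- and `N`. Only `-τ s Lψ` is left.
    · have hcross : crossCoeff τ r (weight (mixFn r) M κ) p =
          -(((τ * s : ℝ) : ℂ) * holDeriv (toComplex (weight (mixFn r) M κ)) p (tang r p)) := by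
        have h0 : complexHessian r p (tang r p) (nrm r p) = 0 := by
          rw [← conj_complexHessian hr]
          have : complexHessian r p (nrm r p) (tang r p) = 0 := hg
          rw [this, map_zero]
        simp [crossCoeff, h0, hzero p hp, ← hsdef]
      rw [hcross, norm_neg, norm_mul, mul_pow, ← hDdef, Complex.norm_real, Real.norm_eq_abs, sq_abs]
      have hlow : D * (1 / (1 - τ)) < -(x / s) - δ + tangCoeff τ r (weight (mixFn r) M κ) p := by
        have hτD : τ * D ≤ D := by nlinarith
        have : D * c = D + D * (1 / (1 - τ)) := by rw [hc]; ring
        unfold tangCoeff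
        rw [← hDdef]
        linarith
      have h3 : D * (1 / (1 - τ)) * (1 - τ) = D := by field_simp
      calc (τ * s) ^ 2 * D ≤ 1 ^ 2 * s ^ 2 * D := by rw [mul_pow]; gcongr
        _ = (D * (1 / (1 - τ))) * ((1 - τ) * s ^ 2) := by
          rw [← mul_assoc, h3]; ring
        _ < _ := by gcongr
  · have hF0 : 0 < (leviFn r p).re := by
      refine lt_of_le_of_ne (hlevi p hp) fun h => hF ?_
      exact Complex.ext h.symm (im_complexHessian_self hr _ _)
    set P := tangCoeff τ r (weight (mixFn r) M κ) p with hP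
    set C := (1 - τ) * gradSq r p ^ 2 with hC
    have hC0 : 0 < C := by positivity
    -- Here `F > 0` while `l (-r)` vanishes at `p`, so `l` can be taken as large as the two
    -- inequalities require.
    refine condForm_nonneg_near hr hψ
      (l := |P| + 1 + ‖crossCoeff τ r (weight (mixFn r) M κ) p‖ ^ 2 / C) (hzero p hp) hs ?_ ?_ ?_
    · set l := |P| + 1 + ‖crossCoeff τ r (weight (mixFn r) M κ) p‖ ^ 2 / C
      have hc1 : Continuous fun q => l * (-r q) := continuous_const.mul hr.continuous.neg
      have hlt : l * (-r p) < (leviFn r p).re := by rw [hzero p hp]; simpa using hF0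
      filter_upwards [hc1.continuousAt.eventually_lt (contDiff_re_leviFn hr).continuous.continuousAt
        hlt] with q hq _ using hq.le
    · have := neg_abs_le P
      have h2 : 0 ≤ ‖crossCoeff τ r (weight (mixFn r) M κ) p‖ ^ 2 / C := by positivity
      linarith
    · have := neg_abs_le P
      have h2 : ‖crossCoeff τ r (weight (mixFn r) M κ) p‖ ^ 2 / C * C =
        ‖crossCoeff τ r (weight (mixFn r) M κ) p‖ ^ 2 := by field_simp
      nlinarith

/-! ### Second derivatives along curves -/

section Curves

variable {E : Type*} [NormedAddCommGroup E] [NormedSpace ℝ E]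

lemma hasDerivAt_comp_curve {u : E → ℝ} (hu : ContDiff ℝ ∞ u) {γ : ℝ → E} {v : E} {t : ℝ}
    (hγ : HasDerivAt γ v t) : HasDerivAt (fun t => u (γ t)) (fderiv ℝ u (γ t) v) t :=
  (differentiable_of_smooth hu _).hasFDerivAt.comp_hasDerivAt t hγ

lemma hasDerivAt_fderiv_curve {u : E → ℝ} (hu : ContDiff ℝ ∞ u) {γ γ' : ℝ → E} {a : E} {t : ℝ}
    (hγ : HasDerivAt γ (γ' t) t) (hγ' : HasDerivAt γ' a t) :
    HasDerivAt (fun t => fderiv ℝ u (γ t) (γ' t))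
      (sndDeriv u (γ t) (γ' t) (γ' t) + fderiv ℝ u (γ t) a) t := by
  have h : DifferentiableAt ℝ (fderiv ℝ u) (γ t) :=
    differentiable_of_smooth (hu.fderiv_right (m := ∞) (by simp)) _
  exact (h.hasFDerivAt.comp_hasDerivAt t hγ).clm_apply hγ'

lemma continuous_sndDeriv {u : E → ℝ} (hu : ContDiff ℝ ∞ u) {α : Type*} [TopologicalSpace α]
    {p X Y : α → E} (hp : Continuous p) (hX : Continuous X) (hY : Continuous Y) :
    Continuous fun a => sndDeriv u (p a) (X a) (Y a) := by
  have h1 : ContDiff ℝ ∞ (fderiv ℝ (fderiv ℝ u)) :=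
    (hu.fderiv_right (m := ∞) (by simp)).fderiv_right (m := ∞) (by simp)
  exact ((h1.continuous.comp hp).clm_apply hX).clm_apply hY

lemma continuous_fderiv_apply_field {u : E → ℝ} (hu : ContDiff ℝ ∞ u) {α : Type*}
    [TopologicalSpace α] {p X : α → E} (hp : Continuous p) (hX : Continuous X) :
    Continuous fun a => fderiv ℝ u (p a) (X a) :=
  ((hu.fderiv_right (m := ∞) (by simp)).continuous.comp hp).clm_apply hX

lemma sndDeriv_congr {f g : E → ℝ} {p : E} (h : f =ᶠ[𝓝 p] g) : sndDeriv f p = sndDeriv g p := by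
  funext X Y
  simp only [sndDeriv, (h.fderiv (𝕜 := ℝ)).fderiv_eq]

end Curves

/-! ### The sub-mean value inequality -/

lemma hasDerivAt_intervalIntegral_of_continuous {F F' : ℝ → ℝ → ℝ} {a b : ℝ}
    (hF : Continuous (Function.uncurry F)) (hF' : Continuous (Function.uncurry F'))
    (hd : ∀ t θ, HasDerivAt (fun t => F t θ) (F' t θ) t) (t : ℝ) :
    HasDerivAt (fun t => ∫ θ in a..b, F t θ) (∫ θ in a..b, F' t θ) t := by
  have hc : ∀ t, Continuous (F t) := fun t => hF.comp (by fun_prop : Continuous fun θ => (t, θ))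
  have hc' : ∀ t, Continuous (F' t) := fun t => hF'.comp (by fun_prop : Continuous fun θ => (t, θ))
  obtain ⟨C, hC⟩ := ((isCompact_closedBall t 1).prod (isCompact_uIcc (a := a) (b := b))).exists_bound_of_continuousOn
    hF'.continuousOn
  refine (intervalIntegral.hasDerivAt_integral_of_dominated_loc_of_deriv_le (bound := fun _ => C)
    (Metric.closedBall_mem_nhds t one_pos) (Eventually.of_forall fun x => (hc x).aestronglyMeasurable)
    ((hc t).intervalIntegrable _ _) (hc' t).aestronglyMeasurable
    (Eventually.of_forall fun θ hθ x hx => ?_) intervalIntegrable_const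
    (Eventually.of_forall fun θ _ x _ => hd x θ)).2
  exact hC (x, θ) ⟨hx, Set.uIoc_subset_uIcc hθ⟩

/-- The point `s e^{iθ} w`. -/
def polarPoint (w : C2) (s θ : ℝ) : C2 := ((s : ℂ) * Complex.exp (θ * Complex.I)) • w

lemma continuous_polarPoint (w : C2) {α : Type*} [TopologicalSpace α] {s θ : α → ℝ}
    (hs : Continuous s) (hθ : Continuous θ) : Continuous fun a => polarPoint w (s a) (θ a) := by
  unfold polarPoint
  fun_prop

lemma hasDerivAt_polarPoint_exp (w : C2) (t θ : ℝ) :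
    HasDerivAt (fun t => polarPoint w (Real.exp t) θ) (polarPoint w (Real.exp t) θ) t := by
  have h := (((Real.hasDerivAt_exp t).ofReal_comp).mul_const
    (Complex.exp (θ * Complex.I))).smul_const w
  exact h

lemma hasDerivAt_polarPoint_angle (w : C2) (s θ : ℝ) :
    HasDerivAt (fun θ => polarPoint w s θ) (Complex.I • polarPoint w s θ) θ := by
  have h0 : HasDerivAt (fun θ : ℝ => (θ : ℂ) * Complex.I) Complex.I θ := by
    simpa using ((hasDerivAt_id θ).ofReal_comp).mul_const Complex.I
  have h := ((h0.cexp).const_mul (s : ℂ)).smul_const w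
  have e : Complex.I • polarPoint w s θ =
      ((s : ℂ) * (Complex.exp (θ * Complex.I) * Complex.I)) • w := by
    rw [polarPoint, smul_smul]
    congr 1
    ring
  rw [e]
  exact h

lemma polarPoint_two_pi (w : C2) (s : ℝ) : polarPoint w s (2 * Real.pi) = polarPoint w s 0 := by
  simp [polarPoint, Complex.exp_two_pi_mul_I]

/-- In the variable `t = log` of the radius, the circle integral `B` is convex for `t ≤ 0`, and its
derivative tends to `0` at `-∞`. So `B` increases from its limit `2π u(z)`. -/
lemma le_circleAverage_of_smooth {u : C2 → ℝ} (hu : ContDiff ℝ ∞ u) {z w : C2}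
    (h : ∀ ζ : ℂ, ‖ζ‖ ≤ 1 → ∀ X, 0 ≤ sndDeriv u (z + ζ • w) X X +
      sndDeriv u (z + ζ • w) (Complex.I • X) (Complex.I • X)) :
    u z ≤ Real.circleAverage (fun ζ : ℂ => u (z + ζ • w)) 0 1 := by
  set P := polarPoint w with hP
  have hPc : ∀ {α : Type} [TopologicalSpace α] {s θ : α → ℝ}, Continuous s → Continuous θ →
    Continuous fun a => P (s a) (θ a) := fun hs hθ => continuous_polarPoint w hs hθ
  have hPt := hasDerivAt_polarPoint_exp w
  have hPθ := hasDerivAt_polarPoint_angle w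
  rw [← hP] at hPt hPθ
  set B : ℝ → ℝ := fun t => ∫ θ in (0 : ℝ)..2 * Real.pi, u (z + P (Real.exp t) θ) with hB
  set B₁ : ℝ → ℝ := fun t => ∫ θ in (0 : ℝ)..2 * Real.pi,
    fderiv ℝ u (z + P (Real.exp t) θ) (P (Real.exp t) θ) with hB₁
  set B₂ : ℝ → ℝ := fun t => ∫ θ in (0 : ℝ)..2 * Real.pi,
    (sndDeriv u (z + P (Real.exp t) θ) (P (Real.exp t) θ) (P (Real.exp t) θ) +
      fderiv ℝ u (z + P (Real.exp t) θ) (P (Real.exp t) θ)) with hB₂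
  have cP : Continuous fun x : ℝ × ℝ => P (Real.exp x.1) x.2 := hPc (by fun_prop) (by fun_prop)
  have cz : Continuous fun x : ℝ × ℝ => z + P (Real.exp x.1) x.2 := continuous_const.add cP
  have hd1 : ∀ t, HasDerivAt B (B₁ t) t := fun t =>
    hasDerivAt_intervalIntegral_of_continuous (F := fun t θ => u (z + P (Real.exp t) θ))
      (F' := fun t θ => fderiv ℝ u (z + P (Real.exp t) θ) (P (Real.exp t) θ))
      (hu.continuous.comp cz)
      (continuous_fderiv_apply_field hu cz cP)
      (fun t θ => hasDerivAt_comp_curve hu ((hPt t θ).const_add z)) t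
  have hd2 : ∀ t, HasDerivAt B₁ (B₂ t) t := fun t =>
    hasDerivAt_intervalIntegral_of_continuous
      (F := fun t θ => fderiv ℝ u (z + P (Real.exp t) θ) (P (Real.exp t) θ))
      (F' := fun t θ => sndDeriv u (z + P (Real.exp t) θ) (P (Real.exp t) θ) (P (Real.exp t) θ) +
        fderiv ℝ u (z + P (Real.exp t) θ) (P (Real.exp t) θ))
      (continuous_fderiv_apply_field hu cz cP)
      ((continuous_sndDeriv hu cz cP cP).add (continuous_fderiv_apply_field hu cz cP))
      (fun t θ => hasDerivAt_fderiv_curve hu ((hPt t θ).const_add z) (hPt t θ)) t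
  have hB₂ : ∀ t ≤ 0, 0 ≤ B₂ t := fun t ht => by
    have cθ : Continuous fun θ => P (Real.exp t) θ := hPc (by fun_prop) (by fun_prop)
    have cI : Continuous fun θ => Complex.I • P (Real.exp t) θ := (continuous_const_smul Complex.I).comp cθ
    have cN : Continuous fun θ => -P (Real.exp t) θ := cθ.neg
    have czθ : Continuous fun θ => z + P (Real.exp t) θ := continuous_const.add cθ
    have c1 := (continuous_sndDeriv hu czθ cθ cθ).add (continuous_fderiv_apply_field hu czθ cθ)
    have c2 := (continuous_sndDeriv hu czθ cI cI).add (continuous_fderiv_apply_field hu czθ cN)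
    have hθ : ∀ θ, HasDerivAt (fun θ => fderiv ℝ u (z + P (Real.exp t) θ)
        (Complex.I • P (Real.exp t) θ))
        (sndDeriv u (z + P (Real.exp t) θ) (Complex.I • P (Real.exp t) θ)
          (Complex.I • P (Real.exp t) θ) +
          fderiv ℝ u (z + P (Real.exp t) θ) (-P (Real.exp t) θ)) θ := fun θ => by
      refine hasDerivAt_fderiv_curve hu ((hPθ (Real.exp t) θ).const_add z) ?_
      have := (hPθ (Real.exp t) θ).const_smul Complex.I
      rwa [smul_smul, Complex.I_mul_I, neg_one_smul] at this
    -- The second angular derivative integrates to zero by periodicity. Adding it to `B₂` cancels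
    -- the first-order terms and leaves the Hessian on `P` plus that on `iP`.
    have hzero := intervalIntegral.integral_eq_sub_of_hasDerivAt (a := 0) (b := 2 * Real.pi)
      (fun θ _ => hθ θ) (c2.intervalIntegrable _ _)
    have h2π : P (Real.exp t) (2 * Real.pi) = P (Real.exp t) 0 := polarPoint_two_pi w _
    rw [h2π, sub_self] at hzero
    have hsum : B₂ t = ∫ θ in (0 : ℝ)..2 * Real.pi,
        (sndDeriv u (z + P (Real.exp t) θ) (P (Real.exp t) θ) (P (Real.exp t) θ) +
        sndDeriv u (z + P (Real.exp t) θ) (Complex.I • P (Real.exp t) θ)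
          (Complex.I • P (Real.exp t) θ)) := by
      have := intervalIntegral.integral_add (μ := MeasureTheory.volume)
        (c1.intervalIntegrable 0 (2 * Real.pi)) (c2.intervalIntegrable 0 (2 * Real.pi))
      simp only [Pi.add_apply] at this
      rw [hzero, add_zero] at this
      refine this.symm.trans ?_
      refine intervalIntegral.integral_congr fun θ _ => ?_
      simp only [map_neg]
      ring
    rw [hsum]
    refine intervalIntegral.integral_nonneg (by positivity) fun θ _ => ?_
    refine h _ ?_ _
    rw [norm_mul, Complex.norm_exp_ofReal_mul_I, mul_one, Complex.norm_real, Real.norm_eq_abs,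
      abs_of_pos (Real.exp_pos t)]
    exact Real.exp_le_one_iff.2 ht
  have hmono1 : MonotoneOn B₁ (Set.Iic 0) := by
    refine monotoneOn_of_hasDerivWithinAt_nonneg (convex_Iic 0)
      (fun t _ => (hd2 t).continuousAt.continuousWithinAt)
      (fun t _ => (hd2 t).hasDerivWithinAt) fun t ht => hB₂ t (interior_subset ht : t ∈ Set.Iic (0 : ℝ))
  have cJ : Continuous fun s : ℝ => ∫ θ in (0 : ℝ)..2 * Real.pi,
      fderiv ℝ u (z + P s θ) (P s θ) := by
    have c0 : Continuous fun x : ℝ × ℝ => P x.1 x.2 := hPc (by fun_prop) (by fun_prop)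
    exact intervalIntegral.continuous_parametric_intervalIntegral_of_continuous'
      (continuous_fderiv_apply_field hu (continuous_const.add c0) c0) _ _
  have cI : Continuous fun s : ℝ => ∫ θ in (0 : ℝ)..2 * Real.pi, u (z + P s θ) := by
    have c0 : Continuous fun x : ℝ × ℝ => P x.1 x.2 := hPc (by fun_prop) (by fun_prop)
    exact intervalIntegral.continuous_parametric_intervalIntegral_of_continuous'
      (f := fun s θ => u (z + P s θ)) (hu.continuous.comp (continuous_const.add c0)) _ _
  have hP0 : ∀ θ, P 0 θ = 0 := fun θ => by simp [hP, polarPoint]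
  have hlim1 : Tendsto B₁ atBot (𝓝 0) := by
    have := (cJ.tendsto 0).comp Real.tendsto_exp_atBot
    simp only [hP0, map_zero, intervalIntegral.integral_zero] at this
    exact this
  have hlim : Tendsto B atBot (𝓝 (2 * Real.pi * u z)) := by
    have := (cI.tendsto 0).comp Real.tendsto_exp_atBot
    simp only [hP0, add_zero, intervalIntegral.integral_const, sub_zero, smul_eq_mul] at this
    exact this
  have hnn1 : ∀ t ≤ 0, 0 ≤ B₁ t := fun t ht =>
    le_of_tendsto hlim1 ((eventually_le_atBot t).mono fun s hs => hmono1 (hs.trans ht) ht hs)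
  have hmono : MonotoneOn B (Set.Iic 0) := by
    refine monotoneOn_of_hasDerivWithinAt_nonneg (convex_Iic 0)
      (fun t _ => (hd1 t).continuousAt.continuousWithinAt)
      (fun t _ => (hd1 t).hasDerivWithinAt) fun t ht => hnn1 t (interior_subset ht : t ∈ Set.Iic (0 : ℝ))
  have hfin : 2 * Real.pi * u z ≤ B 0 :=
    le_of_tendsto hlim ((eventually_le_atBot 0).mono fun s hs => hmono hs (le_refl (0 : ℝ)) hs)
  have havg : Real.circleAverage (fun ζ : ℂ => u (z + ζ • w)) 0 1 = (2 * Real.pi)⁻¹ * B 0 := by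
    simp [Real.circleAverage, hB, hP, polarPoint, circleMap]
  rw [havg, ← div_eq_inv_mul, le_div_iff₀ (by positivity)]
  linarith

/-- A smooth function with nonnegative complex Hessian is plurisubharmonic. -/
lemma isPlurisubharmonicOn_of_sndDeriv {Ω : Set C2} (hΩ : IsOpen Ω) {u : C2 → ℝ}
    (hu : ContDiffOn ℝ ∞ u Ω) (h : ∀ p ∈ Ω, ∀ X, 0 ≤ sndDeriv u p X X +
      sndDeriv u p (Complex.I • X) (Complex.I • X)) : IsPlurisubharmonicOn u Ω := by
  refine ⟨hu.continuousOn.upperSemicontinuousOn, fun z hz w hw => ⟨?_, ?_⟩⟩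
  · refine ContinuousOn.circleIntegrable zero_le_one ?_
    refine hu.continuousOn.comp (by fun_prop) fun ζ hζ => hw ζ ?_
    simpa using (mem_sphere_zero_iff_norm.1 hζ).le
  · set K := (fun ζ : ℂ => z + ζ • w) '' Metric.closedBall 0 1 with hK
    have hKc : IsCompact K := (isCompact_closedBall 0 1).image (by fun_prop)
    have hKΩ : K ⊆ Ω := by
      rintro _ ⟨ζ, hζ, rfl⟩
      exact hw ζ (by simpa using hζ)
    -- The inequality on the disc sees `u` only near the compact disc, where a globally smooth `v`
    -- can take its place.
    obtain ⟨v, hv, hvu⟩ := exists_contDiff_eventuallyEq hΩ hKc.isClosed hKΩ hu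
    have hmem : ∀ ζ : ℂ, ‖ζ‖ ≤ 1 → z + ζ • w ∈ K := fun ζ hζ => ⟨ζ, by simpa using hζ, rfl⟩
    have hvz : v z = u z := by
      have := (hvu _ (hmem 0 (by simp))).self_of_nhds
      simpa using this
    rw [← hvz]
    have havg : Real.circleAverage (fun ζ : ℂ => u (z + ζ • w)) 0 1 =
        Real.circleAverage (fun ζ : ℂ => v (z + ζ • w)) 0 1 := by
      refine Real.circleAverage_congr_sphere fun ζ hζ => ?_
      have hζ1 : ‖ζ‖ ≤ 1 := by
        rw [abs_one] at hζ
        exact (mem_sphere_zero_iff_norm.1 hζ).le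
      exact (hvu _ (hmem ζ hζ1)).self_of_nhds.symm
    rw [havg]
    refine le_circleAverage_of_smooth hv fun ζ hζ X => ?_
    rw [sndDeriv_congr (hvu _ (hmem ζ hζ))]
    exact h _ (hKΩ (hmem ζ hζ)) X

/-! ### Composition with a concave cutoff -/

/-- The integral of a smooth decreasing step from `1` to `0`. It keeps the function unchanged near
the boundary, where `log (-r) - ψ` is very negative, and makes it constant deep inside. -/
lemma exists_concave_cutoff (a : ℝ) : ∃ m m₁ m₂ : ℝ → ℝ, ContDiff ℝ ∞ m ∧
    (∀ t, HasDerivAt m (m₁ t) t) ∧ (∀ t, HasDerivAt m₁ (m₂ t) t) ∧ (∀ t ≤ a, m t = t) ∧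
    (∀ t, 0 ≤ m₁ t) ∧ (∀ t, m₁ t ≤ 1) ∧ (∀ t, m₂ t ≤ 0) ∧ ∀ t, a + 1 ≤ t → m₁ t = 0 := by
  set m₁ : ℝ → ℝ := fun t => 1 - Real.smoothTransition (t - a) with hm₁
  have hsm : ContDiff ℝ ∞ m₁ :=
    contDiff_const.sub (Real.smoothTransition.contDiff.comp (contDiff_id.sub contDiff_const))
  have hder : ∀ t, HasDerivAt (fun t => a + ∫ x in a..t, m₁ x) (m₁ t) t := fun t =>
    (intervalIntegral.integral_hasDerivAt_right (hsm.continuous.intervalIntegrable _ _)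
      (hsm.continuous.stronglyMeasurableAtFilter _ _) hsm.continuous.continuousAt).const_add a
  have hanti : Antitone m₁ := fun x y hxy =>
    sub_le_sub_left (Real.smoothTransition.monotone (sub_le_sub_right hxy a)) 1
  refine ⟨fun t => a + ∫ x in a..t, m₁ x, m₁, deriv m₁, ?_, hder,
    fun t => (differentiable_of_smooth hsm t).hasDerivAt, fun t ht => ?_,
    fun t => sub_nonneg.2 (Real.smoothTransition.le_one _),
    fun t => sub_le_self _ (Real.smoothTransition.nonneg _), fun t => hanti.deriv_nonpos, fun t ht => ?_⟩
  · refine contDiff_infty_iff_deriv.2 ⟨fun t => (hder t).differentiableAt, ?_⟩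
    rwa [funext fun t => (hder t).deriv]
  · have : ∫ x in a..t, m₁ x = ∫ x in a..t, (1 : ℝ) := by
      refine intervalIntegral.integral_congr fun x hx => ?_
      rw [Set.uIcc_of_ge ht] at hx
      simp [hm₁, Real.smoothTransition.zero_of_nonpos (sub_nonpos.2 hx.2)]
    simp [this]
  · simp [hm₁, Real.smoothTransition.one_of_one_le (by linarith : 1 ≤ t - a)]

/-- The identity near `0`, and `-exp (m (log (-x)))` for negative `x`. -/
def logConj (m : ℝ → ℝ) (a x : ℝ) : ℝ :=
  if -Real.exp a < x then x else -Real.exp (m (Real.log (-x)))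

lemma logConj_of_lt {m : ℝ → ℝ} {a x : ℝ} (hx : -Real.exp a < x) : logConj m a x = x :=
  if_pos hx

lemma logConj_of_neg {m : ℝ → ℝ} {a : ℝ} (hm : ∀ t ≤ a, m t = t) {x : ℝ} (hx : x < 0) :
    logConj m a x = -Real.exp (m (Real.log (-x))) := by
  unfold logConj
  split_ifs with h
  · have h1 : Real.log (-x) ≤ a := (Real.log_le_iff_le_exp (by linarith)).2 (by linarith)
    rw [hm _ h1, Real.exp_log (by linarith), neg_neg]
  · rfl

/-- The two formulas agree on `(-e^a, 0)`, so `logConj` is locally the identity near `x ≥ 0` and a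
smooth expression for `x < 0`. -/
lemma contDiff_logConj {m : ℝ → ℝ} {a : ℝ} (hsm : ContDiff ℝ ∞ m) (hm : ∀ t ≤ a, m t = t) :
    ContDiff ℝ ∞ (logConj m a) := by
  rw [contDiff_iff_contDiffAt]
  intro x
  rcases lt_or_ge x 0 with hx | hx
  · have h1 : ContDiffAt ℝ ∞ (fun x : ℝ => -Real.exp (m (Real.log (-x)))) x :=
      (Real.contDiff_exp.contDiffAt.comp x (hsm.contDiffAt.comp x
        (contDiffAt_id.neg.log (by simpa using hx.ne)))).neg
    refine h1.congr_of_eventuallyEq ?_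
    filter_upwards [gt_mem_nhds hx] with y hy using logConj_of_neg hm hy
  · refine contDiffAt_id.congr_of_eventuallyEq ?_
    filter_upwards [lt_mem_nhds (lt_of_lt_of_le (neg_lt_zero.2 (Real.exp_pos a)) hx)] with y hy
      using logConj_of_lt hy

lemma logConj_neg_iff {m : ℝ → ℝ} {a : ℝ} (hm : ∀ t ≤ a, m t = t) (x : ℝ) :
    logConj m a x < 0 ↔ x < 0 := by
  constructor
  · intro h
    by_contra! hx
    rw [logConj_of_lt (lt_of_lt_of_le (neg_lt_zero.2 (Real.exp_pos a)) hx)] at h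
    linarith
  · intro hx
    rw [logConj_of_neg hm hx]
    exact neg_lt_zero.2 (Real.exp_pos _)

/-- One-variable computation behind `sndDeriv_exp_cutoff`: `f` and `k` are `r` and `ψ` along a line.
The first derivative is given near `0` so that it can be differentiated once more. -/
lemma hasDerivAt_exp_cutoff {m m₁ m₂ : ℝ → ℝ} (hm : ∀ t, HasDerivAt m (m₁ t) t)
    (hm₁ : ∀ t, HasDerivAt m₁ (m₂ t) t) (τ : ℝ) {f f₁ k k₁ : ℝ → ℝ} {f₂ k₂ : ℝ}
    (hf : ∀ s, HasDerivAt f (f₁ s) s) (hk : ∀ s, HasDerivAt k (k₁ s) s) (hf₁ : HasDerivAt f₁ f₂ 0)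
    (hk₁ : HasDerivAt k₁ k₂ 0) (h0 : f 0 < 0) :
    ∃ g₁ : ℝ → ℝ,
      (∀ᶠ s in 𝓝 0, HasDerivAt (fun s => -Real.exp (τ * m (Real.log (-f s) - k s))) (g₁ s) s) ∧
      HasDerivAt g₁ (-(τ * Real.exp (τ * m (Real.log (-f 0) - k 0)) *
        ((τ * m₁ (Real.log (-f 0) - k 0) ^ 2 + m₂ (Real.log (-f 0) - k 0)) *
            (f₁ 0 / f 0 - k₁ 0) ^ 2
          + m₁ (Real.log (-f 0) - k 0) * (f₂ / f 0 - (f₁ 0 / f 0) ^ 2 - k₂)))) 0 := by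
  have hh : ∀ s, f s < 0 → HasDerivAt (fun s => Real.log (-f s) - k s) (f₁ s / f s - k₁ s) s :=
    fun s hs => by
      have := ((hf s).neg.log (by simpa using hs.ne)).sub (hk s)
      rwa [Pi.neg_apply, neg_div_neg_eq] at this
  have hE : ∀ s, f s < 0 → HasDerivAt (fun s => Real.exp (τ * m (Real.log (-f s) - k s)))
      (Real.exp (τ * m (Real.log (-f s) - k s)) *
        (τ * (m₁ (Real.log (-f s) - k s) * (f₁ s / f s - k₁ s)))) s := fun s hs =>
    (((hm _).comp s (hh s hs)).const_mul τ).exp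
  refine ⟨fun s => -(Real.exp (τ * m (Real.log (-f s) - k s)) *
    (τ * (m₁ (Real.log (-f s) - k s) * (f₁ s / f s - k₁ s)))), ?_, ?_⟩
  · filter_upwards [(hf 0).continuousAt.eventually (gt_mem_nhds h0)] with s hs
    exact (hE s hs).neg
  · have h1 : HasDerivAt (fun s => f₁ s / f s - k₁ s)
        ((f₂ * f 0 - f₁ 0 * f₁ 0) / f 0 ^ 2 - k₂) 0 := (hf₁.div (hf 0) h0.ne).sub hk₁
    have h2 := ((hE 0 h0).mul ((((hm₁ _).comp 0 (hh 0 h0)).mul h1).const_mul τ)).neg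
    refine h2.congr_deriv ?_
    have hne := h0.ne
    simp only [Pi.mul_apply, Function.comp_apply]
    field_simp
    ring

/-- The real second derivative of `-exp (τ m (log (-r) - ψ))`. -/
lemma sndDeriv_exp_cutoff {m m₁ m₂ : ℝ → ℝ} (hsm : ContDiff ℝ ∞ m)
    (hm : ∀ t, HasDerivAt m (m₁ t) t)
    (hm₁ : ∀ t, HasDerivAt m₁ (m₂ t) t) (τ : ℝ) {r ψ : C2 → ℝ} (hr : ContDiff ℝ ∞ r)
    (hψ : ContDiff ℝ ∞ ψ) {p : C2} (hp : r p < 0) (Y : C2) :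
    sndDeriv (fun q => -Real.exp (τ * m (Real.log (-r q) - ψ q))) p Y Y =
      -(τ * Real.exp (τ * m (Real.log (-r p) - ψ p)) *
        ((τ * m₁ (Real.log (-r p) - ψ p) ^ 2 + m₂ (Real.log (-r p) - ψ p)) *
            (fderiv ℝ r p Y / r p - fderiv ℝ ψ p Y) ^ 2
          + m₁ (Real.log (-r p) - ψ p) * (sndDeriv r p Y Y / r p
            - (fderiv ℝ r p Y / r p) ^ 2 - sndDeriv ψ p Y Y))) := by
  have hopen : IsOpen {q | r q < 0} := isOpen_lt hr.continuous continuous_const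
  have hu : ContDiffOn ℝ ∞ (fun q => -Real.exp (τ * m (Real.log (-r q) - ψ q))) {q | r q < 0} := by
    intro q hq
    have hq' : -r q ≠ 0 := by simpa using (ne_of_lt hq)
    exact ((contDiffAt_const.mul (hsm.contDiffAt.comp q
      ((hr.contDiffAt.neg.log hq').sub hψ.contDiffAt))).exp.neg).contDiffWithinAt
  obtain ⟨v, hv, hvu⟩ := exists_contDiff_eventuallyEq hopen (isClosed_singleton (x := p))
    (by simpa using hp) hu
  have hvp := hvu p rfl
  rw [← sndDeriv_congr hvp]
  have hline : ∀ s : ℝ, HasDerivAt (fun s : ℝ => p + s • Y) Y s := fun s => by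
    simpa using ((hasDerivAt_id s).smul_const Y).const_add p
  have hsnd : ∀ {w : C2 → ℝ}, ContDiff ℝ ∞ w →
      HasDerivAt (fun s : ℝ => fderiv ℝ w (p + s • Y) Y) (sndDeriv w p Y Y) 0 := fun {w} hw => by
    simpa using hasDerivAt_fderiv_curve hw (γ' := fun _ => Y) (hline 0) (hasDerivAt_const 0 Y)
  obtain ⟨g₁, hg, hg₁⟩ := hasDerivAt_exp_cutoff hm hm₁ τ
    (fun s => hasDerivAt_comp_curve hr (hline s)) (fun s => hasDerivAt_comp_curve hψ (hline s))
    (hsnd hr) (hsnd hψ) (by simpa using hp)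
  simp only [zero_smul, add_zero] at hg₁
  have hcont : Tendsto (fun s : ℝ => p + s • Y) (𝓝 0) (𝓝 p) := by
    have := (hline 0).continuousAt.tendsto
    simpa using this
  have hev : (fun s : ℝ => fderiv ℝ v (p + s • Y) Y) =ᶠ[𝓝 0] g₁ := by
    filter_upwards [hg, (hcont.eventually hvp).eventually_nhds] with s h1 h2
    exact (hasDerivAt_comp_curve hv (hline s)).unique (h1.congr_of_eventuallyEq h2)
  exact (hsnd hv).unique (hg₁.congr_of_eventuallyEq hev)

/-- With `h = log (-r) - ψ`, the bracket is the sum over the directions `X` and `iX` of the second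
derivative of `h` plus `τ` times the squared first derivative. This is the expression produced by
`-exp (τ h)`. -/
lemma condForm_eq {r ψ : C2 → ℝ} (hr : ContDiff ℝ ∞ r) (hψ : ContDiff ℝ ∞ ψ) (τ : ℝ) {p : C2}
    (hp : r p < 0) (X : C2) : 4 * condForm τ r ψ p X =
      (r p) * ((sndDeriv r p X X / r p - (fderiv ℝ r p X / r p) ^ 2 - sndDeriv ψ p X X)
        + τ * (fderiv ℝ r p X / r p - fderiv ℝ ψ p X) ^ 2
        + (sndDeriv r p (Complex.I • X) (Complex.I • X) / r p
          - (fderiv ℝ r p (Complex.I • X) / r p) ^ 2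
          - sndDeriv ψ p (Complex.I • X) (Complex.I • X))
        + τ * (fderiv ℝ r p (Complex.I • X) / r p - fderiv ℝ ψ p (Complex.I • X)) ^ 2) := by
  unfold condForm
  rw [re_complexHessian_self hr, re_complexHessian_self hψ, holDeriv_toComplex hr,
    holDeriv_toComplex hψ]
  have hn : ∀ a b : ℝ, ‖(1 / 2 : ℂ) * (a - Complex.I * b)‖ ^ 2 = (a ^ 2 + b ^ 2) / 4 :=
    fun a b => by
      rw [Complex.sq_norm, Complex.normSq_apply]
      simp
      ring
  have hc : ∀ a b c d : ℝ, ((1 / 2 : ℂ) * (a - Complex.I * b) *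
      starRingEnd ℂ ((1 / 2 : ℂ) * (c - Complex.I * d))).re = (a * c + b * d) / 4 :=
    fun a b c d => by
      simp
      ring
  rw [hn, hn, hc]
  have hne := hp.ne
  field_simp
  ring

/-- The composition has nonnegative complex Hessian where the cutoff is constant or `condForm` is
nonnegative. -/
lemma sndDeriv_exp_cutoff_nonneg {m m₁ m₂ : ℝ → ℝ} (hsm : ContDiff ℝ ∞ m)
    (hm : ∀ t, HasDerivAt m (m₁ t) t) (hm₁ : ∀ t, HasDerivAt m₁ (m₂ t) t)
    (h0 : ∀ t, 0 ≤ m₁ t) (h1 : ∀ t, m₁ t ≤ 1) (h2 : ∀ t, m₂ t ≤ 0)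
    {τ : ℝ} (hτ : 0 < τ) {r ψ : C2 → ℝ} (hr : ContDiff ℝ ∞ r)
    (hψ : ContDiff ℝ ∞ ψ) {p : C2} (hp : r p < 0) (X : C2)
    (hX : m₁ (Real.log (-r p) - ψ p) = 0 ∨ 0 ≤ condForm τ r ψ p X) :
    0 ≤ sndDeriv (fun q => -Real.exp (τ * m (Real.log (-r q) - ψ q))) p X X +
      sndDeriv (fun q => -Real.exp (τ * m (Real.log (-r q) - ψ q))) p
        (Complex.I • X) (Complex.I • X) := by
  rw [sndDeriv_exp_cutoff hsm hm hm₁ τ hr hψ hp, sndDeriv_exp_cutoff hsm hm hm₁ τ hr hψ hp]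
  have hQ := condForm_eq hr hψ τ hp X
  set t := Real.log (-r p) - ψ p
  have hE : 0 < Real.exp (τ * m t) := Real.exp_pos _
  have g0 := h0 t
  have g1 := h1 t
  have g2 := h2 t
  generalize Real.exp (τ * m t) = E at *
  generalize m₁ t = μ at *
  generalize m₂ t = ν at *
  generalize sndDeriv r p X X / r p - (fderiv ℝ r p X / r p) ^ 2 - sndDeriv ψ p X X = A at *
  generalize sndDeriv r p (Complex.I • X) (Complex.I • X) / r p
    - (fderiv ℝ r p (Complex.I • X) / r p) ^ 2
    - sndDeriv ψ p (Complex.I • X) (Complex.I • X) = B at *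
  generalize fderiv ℝ r p X / r p - fderiv ℝ ψ p X = x at *
  generalize fderiv ℝ r p (Complex.I • X) / r p - fderiv ℝ ψ p (Complex.I • X) = y at *
  have hmain : 0 ≤ μ * (-(A + τ * x ^ 2 + B + τ * y ^ 2)) := by
    rcases hX with h | h
    · simp [h]
    · refine mul_nonneg g0 ?_
      have h4 : 0 ≤ (-r p) * (-(A + τ * x ^ 2 + B + τ * y ^ 2)) := by
        have : (-r p) * (-(A + τ * x ^ 2 + B + τ * y ^ 2)) = 4 * condForm τ r ψ p X := by
          rw [hQ]; ring
        rw [this]; positivity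
      exact nonneg_of_mul_nonneg_right h4 (by linarith)
  -- The error made in replacing `τ μ² + ν` by `τ μ` has the right sign because `0 ≤ μ ≤ 1` and, by
  -- concavity, `ν ≤ 0`.
  have h3 : 0 ≤ (τ * (μ * (1 - μ)) - ν) * (x ^ 2 + y ^ 2) := by
    refine mul_nonneg ?_ (by positivity)
    have := mul_nonneg hτ.le (mul_nonneg g0 (sub_nonneg.2 g1))
    linarith
  have h5 : 0 ≤ τ * E * (μ * (-(A + τ * x ^ 2 + B + τ * y ^ 2))
      + (τ * (μ * (1 - μ)) - ν) * (x ^ 2 + y ^ 2)) :=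
    mul_nonneg (mul_pos hτ hE).le (add_nonneg hmain h3)
  linarith [h5]

/-! ### Comparison of two defining functions -/

section Compare

variable {E : Type*} [NormedAddCommGroup E] [NormedSpace ℝ E]

lemma eventually_neg_of_hasDerivAt_neg {f : ℝ → ℝ} {f' : ℝ} (hf : HasDerivAt f f' 0)
    (h0 : f 0 = 0) (hf' : f' < 0) : ∀ᶠ s in 𝓝[>] (0 : ℝ), f s < 0 := by
  have hslope := hasDerivAt_iff_tendsto_slope.1 hf
  have h1 := (hslope.mono_left (nhdsWithin_mono 0 (fun x hx => (ne_of_gt hx))) :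
    Tendsto _ (𝓝[>] (0 : ℝ)) _).eventually (gt_mem_nhds hf')
  filter_upwards [h1, self_mem_nhdsWithin] with t ht ht0
  have ht0 : 0 < t := ht0
  simp only [slope, vsub_eq_sub, smul_eq_mul, sub_zero, h0] at ht
  exact neg_of_mul_neg_right ht (inv_nonneg.2 ht0.le)

variable {r r₀ : E → ℝ} {p : E}

lemma fderiv_nonpos_of_fderiv_neg (hr : ContDiff ℝ ∞ r) (hr₀ : ContDiff ℝ ∞ r₀)
    (hp : r p = 0) (hp₀ : r₀ p = 0) (hsign : ∀ᶠ z in 𝓝 p, r₀ z < 0 ↔ r z < 0) {V : E}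
    (hV : fderiv ℝ r p V < 0) : fderiv ℝ r₀ p V ≤ 0 := by
  by_contra! hV₀
  have hline : HasDerivAt (fun s : ℝ => p + s • V) V 0 := by
    simpa using ((hasDerivAt_id (0 : ℝ)).smul_const V).const_add p
  have h1 := hasDerivAt_comp_curve hr hline
  have h2 := (hasDerivAt_comp_curve hr₀ hline).neg
  simp only [zero_smul, add_zero] at h1 h2
  have e1 := eventually_neg_of_hasDerivAt_neg h1 (by simpa using hp) hV
  have e2 := eventually_neg_of_hasDerivAt_neg h2 (by simpa using hp₀) (by linarith)
  have hcont : Tendsto (fun s : ℝ => p + s • V) (𝓝 0) (𝓝 p) := by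
    simpa using hline.continuousAt.tendsto
  obtain ⟨s, h3, h4, h5⟩ := (e1.and (e2.and (nhdsWithin_le_nhds (hcont.eventually hsign)))).exists
  have := h5.2 h3
  simp only [Pi.neg_apply] at h4
  linarith

/-- The differential of `r₀` is nonpositive on the open half-space where that of `r` is negative,
hence on its bounding hyperplane; replacing `V` by `-V` makes it vanish there. -/
lemma exists_fderiv_eq_smul (hr : ContDiff ℝ ∞ r) (hr₀ : ContDiff ℝ ∞ r₀)
    (hp : r p = 0) (hp₀ : r₀ p = 0) (hsign : ∀ᶠ z in 𝓝 p, r₀ z < 0 ↔ r z < 0)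
    (hd : fderiv ℝ r p ≠ 0) (hd₀ : fderiv ℝ r₀ p ≠ 0) :
    ∃ c : ℝ, 0 < c ∧ fderiv ℝ r₀ p = c • fderiv ℝ r p := by
  have hle : ∀ V, fderiv ℝ r p V < 0 → fderiv ℝ r₀ p V ≤ 0 := fun V =>
    fderiv_nonpos_of_fderiv_neg hr hr₀ hp hp₀ hsign
  obtain ⟨n, hn⟩ : ∃ n, fderiv ℝ r p n < 0 := by
    obtain ⟨n, hn⟩ : ∃ n, fderiv ℝ r p n ≠ 0 := by
      by_contra! h
      exact hd (ContinuousLinearMap.ext h)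
    rcases lt_or_gt_of_ne hn with h | h
    · exact ⟨n, h⟩
    · exact ⟨-n, by simpa using h⟩
  have hker : ∀ V, fderiv ℝ r p V = 0 → fderiv ℝ r₀ p V ≤ 0 := fun V hV => by
    by_contra! h
    -- Small enough that adding `ε • n` changes the value at `V` by less than half, which keeps it
    -- positive.
    set ε := fderiv ℝ r₀ p V / (2 * (|fderiv ℝ r₀ p n| + 1)) with hε
    have hε0 : 0 < ε := by positivity
    have h1 := hle (ε • n + V) (by
      simp only [map_add, map_smul, hV, smul_eq_mul, add_zero]
      exact mul_neg_of_pos_of_neg hε0 hn)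
    simp only [map_add, map_smul, smul_eq_mul] at h1
    have h2 := neg_abs_le (fderiv ℝ r₀ p n)
    have h3 : ε * (2 * (|fderiv ℝ r₀ p n| + 1)) = fderiv ℝ r₀ p V := by
      rw [hε]; field_simp
    nlinarith [abs_nonneg (fderiv ℝ r₀ p n)]
  have hker' : ∀ V, fderiv ℝ r p V = 0 → fderiv ℝ r₀ p V = 0 := fun V hV => by
    have h1 := hker V hV
    have h2 := hker (-V) (by simpa using hV)
    simp only [map_neg] at h2
    linarith
  set c := fderiv ℝ r₀ p n / fderiv ℝ r p n with hc
  have hc0 : 0 ≤ c := div_nonneg_of_nonpos (hle n hn) hn.le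
  have heq : fderiv ℝ r₀ p = c • fderiv ℝ r p := by
    ext V
    have := hker' (V - (fderiv ℝ r p V / fderiv ℝ r p n) • n) (by
      simp only [map_sub, map_smul, smul_eq_mul]
      field_simp [hn.ne]
      simp)
    simp only [map_sub, map_smul, smul_eq_mul] at this
    simp only [smul_apply, smul_eq_mul, hc]
    have hne := hn.ne
    field_simp at this ⊢
    linarith
  refine ⟨c, lt_of_le_of_ne hc0 fun h => hd₀ ?_, heq⟩
  rw [heq, ← h, zero_smul]

/-- The second derivative along the parabola `p + t X + t² V`. -/
lemma deriv_deriv_parabola (hr : ContDiff ℝ ∞ r) (p X V : E) :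
    deriv (fun t : ℝ => r (p + t • X + t ^ 2 • V)) 0 = fderiv ℝ r p X ∧
    deriv (deriv (fun t : ℝ => r (p + t • X + t ^ 2 • V))) 0 =
      sndDeriv r p X X + 2 * fderiv ℝ r p V := by
  have h1 : ∀ t, HasDerivAt (fun t : ℝ => p + t • X + t ^ 2 • V) (X + (2 * t) • V) t := fun t => by
    have := (((hasDerivAt_id t).smul_const X).const_add p).add
      (((hasDerivAt_id t).pow 2).smul_const V)
    refine (this.congr_deriv ?_)
    simp
  have h2 : ∀ t, HasDerivAt (fun t : ℝ => X + (2 * t) • V) ((2 : ℝ) • V) t := fun t => by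
    have := (((hasDerivAt_id t).const_mul 2).smul_const V).const_add X
    refine (this.congr_deriv ?_)
    simp
  have h3 : deriv (fun t : ℝ => r (p + t • X + t ^ 2 • V)) =
      fun t => fderiv ℝ r (p + t • X + t ^ 2 • V) (X + (2 * t) • V) :=
    funext fun t => (hasDerivAt_comp_curve hr (h1 t)).deriv
  rw [h3]
  refine ⟨by simp, ?_⟩
  rw [(hasDerivAt_fderiv_curve hr (γ' := fun t : ℝ => X + (2 * t) • V) (h1 0) (h2 0)).deriv]
  simp

/-- The functions are compared along parabolas `p + tX + t²V`, where `V` tunes the second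
derivative. The proportional differentials turn the shift of one into `c` times the shift of the
other. -/
lemma sndDeriv_le_of_sign (hr : ContDiff ℝ ∞ r) (hr₀ : ContDiff ℝ ∞ r₀)
    (hp : r p = 0) (hp₀ : r₀ p = 0) (hsign : ∀ᶠ z in 𝓝 p, r₀ z < 0 ↔ r z < 0)
    (hd : fderiv ℝ r p ≠ 0) {c : ℝ} (hc : fderiv ℝ r₀ p = c • fderiv ℝ r p) {X : E}
    (hX : fderiv ℝ r p X = 0) : sndDeriv r₀ p X X ≤ c * sndDeriv r p X X := by
  have hX₀ : fderiv ℝ r₀ p X = 0 := by rw [hc]; simp [hX]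
  -- If the second derivatives had opposite strict signs, `r ≤ 0 ≤ r₀` would hold along the
  -- parabola. As both have the same negativity set, `r` would vanish on it near `t = 0`, against
  -- its nonzero second derivative.
  have key : ∀ V, sndDeriv r p X X + 2 * fderiv ℝ r p V < 0 →
      sndDeriv r₀ p X X + 2 * fderiv ℝ r₀ p V ≤ 0 := fun V hV => by
    by_contra! hV₀
    obtain ⟨d1, d2⟩ := deriv_deriv_parabola hr p X V
    obtain ⟨d1', d2'⟩ := deriv_deriv_parabola hr₀ p X V
    have hγ : Continuous fun t : ℝ => p + t • X + t ^ 2 • V := by fun_prop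
    have hmax : IsLocalMax (fun t : ℝ => r (p + t • X + t ^ 2 • V)) 0 :=
      isLocalMax_of_deriv_deriv_neg (d2.trans_lt hV) (d1.trans hX)
        (hr.continuous.comp hγ).continuousAt
    have hmin : IsLocalMin (fun t : ℝ => r₀ (p + t • X + t ^ 2 • V)) 0 :=
      isLocalMin_of_deriv_deriv_pos (hV₀.trans_eq d2'.symm) (d1'.trans hX₀)
        (hr₀.continuous.comp hγ).continuousAt
    have hcont : Tendsto (fun t : ℝ => p + t • X + t ^ 2 • V) (𝓝 0) (𝓝 p) := by
      simpa using hγ.tendsto 0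
    have hzero : (fun t : ℝ => r (p + t • X + t ^ 2 • V)) =ᶠ[𝓝 0] fun _ => 0 := by
      filter_upwards [hmax, hmin, hcont.eventually hsign] with t h1 h2 h3
      simp only [zero_smul, add_zero, ne_eq, OfNat.ofNat_ne_zero, not_false_eq_true, zero_pow,
        hp, hp₀] at h1 h2
      by_contra hne
      have := h3.2 (lt_of_le_of_ne h1 hne)
      linarith
    have := hzero.deriv.deriv_eq
    rw [d2] at this
    simp only [deriv_const', deriv_const] at this
    linarith
  obtain ⟨n, hn⟩ : ∃ n, fderiv ℝ r p n ≠ 0 := by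
    by_contra! h
    exact hd (ContinuousLinearMap.ext h)
  have hc0 : ∀ y, sndDeriv r p X X < y → sndDeriv r₀ p X X ≤ c * y := fun y hy => by
    -- This multiple of `n` shifts the second derivative of `r` by exactly `-y`, just below zero as
    -- `y` decreases to `sndDeriv r p X X`.
    have h1 := key ((-y / (2 * fderiv ℝ r p n)) • n) (by
      simp only [map_smul, smul_eq_mul]
      have : 2 * (-y / (2 * fderiv ℝ r p n) * fderiv ℝ r p n) = -y := by field_simp
      linarith)
    rw [hc] at h1
    simp only [smul_apply, map_smul, smul_eq_mul] at h1
    have : 2 * (-y / (2 * fderiv ℝ r p n) * (c * fderiv ℝ r p n)) = -(c * y) := by field_simp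
    linarith
  have hlim : Tendsto (fun y : ℝ => c * y) (𝓝[>] (sndDeriv r p X X)) (𝓝 (c * sndDeriv r p X X)) :=
    ((continuous_const.mul continuous_id).tendsto _).mono_left nhdsWithin_le_nhds
  exact ge_of_tendsto hlim (by filter_upwards [self_mem_nhdsWithin] with y hy using hc0 y hy)

end Compare

lemma re_leviFn_nonneg_of_sign {r r₀ : C2 → ℝ} {p : C2} (hr : ContDiff ℝ ∞ r)
    (hr₀ : ContDiff ℝ ∞ r₀) (hp : r p = 0) (hp₀ : r₀ p = 0)
    (hsign : ∀ᶠ z in 𝓝 p, r₀ z < 0 ↔ r z < 0) (hd : fderiv ℝ r p ≠ 0) (hd₀ : fderiv ℝ r₀ p ≠ 0)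
    (hpsc : ∀ X, IsComplexTangent r₀ p X → 0 ≤ (complexHessian r₀ p X X).re) :
    0 ≤ (leviFn r p).re := by
  obtain ⟨c, hc0, hc⟩ := exists_fderiv_eq_smul hr hr₀ hp hp₀ hsign hd hd₀
  obtain ⟨h1, h2⟩ := (isComplexTangent_iff hr p _).1 (isComplexTangent_tang r p)
  have h3 := hpsc (tang r p) ((isComplexTangent_iff hr₀ p _).2 (by rw [hc]; simp [h1, h2]))
  rw [re_complexHessian_self hr₀] at h3
  have h4 := sndDeriv_le_of_sign hr hr₀ hp hp₀ hsign hd hc h1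
  have h5 := sndDeriv_le_of_sign hr hr₀ hp hp₀ hsign hd hc h2
  unfold leviFn
  rw [re_complexHessian_self hr]
  have h6 : 0 ≤ c * (sndDeriv r p (tang r p) (tang r p) +
    sndDeriv r p (Complex.I • tang r p) (Complex.I • tang r p)) := by linarith
  have h7 := nonneg_of_mul_nonneg_right h6 hc0
  linarith

/-! ### Global defining functions -/

lemma IsDefiningFunction.eq_zero {Ω : Set C2} {r : C2 → ℝ} (hΩ : IsOpen Ω)
    (h : IsDefiningFunction Ω r) {p : C2} (hp : p ∈ frontier Ω) : r p = 0 := by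
  obtain ⟨⟨U, hU, hcl, hr, hneg⟩, -⟩ := h
  have hpU : p ∈ U := hcl (frontier_subset_closure hp)
  have hpΩ : p ∉ Ω := fun h => by
    rw [hΩ.frontier_eq] at hp
    exact hp.2 h
  refine le_antisymm ?_ (not_lt.1 fun h => hpΩ ((hneg p hpU).2 h))
  have hc : ContinuousAt r p := hr.continuousOn.continuousAt (hU.mem_nhds hpU)
  have hne : (𝓝[Ω] p).NeBot := mem_closure_iff_nhdsWithin_neBot.1 (frontier_subset_closure hp)
  refine le_of_tendsto (hc.tendsto.mono_left (nhdsWithin_le_nhds (s := Ω))) ?_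
  filter_upwards [self_mem_nhdsWithin, nhdsWithin_le_nhds (hU.mem_nhds hpU)] with z hz hzU
  exact ((hneg z hzU).1 hz).le

lemma IsDefiningFunction.exists_contDiff {Ω : Set C2} {r : C2 → ℝ}
    (h : IsDefiningFunction Ω r) : ∃ r' : C2 → ℝ, ContDiff ℝ ∞ r' ∧ IsDefiningFunction Ω r' ∧
      ∀ p ∈ closure Ω, r' =ᶠ[𝓝 p] r := by
  obtain ⟨⟨U, hU, hcl, hr, hneg⟩, hgrad⟩ := h
  obtain ⟨r', hr', heq⟩ := exists_contDiff_eventuallyEq hU isClosed_closure hcl hr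
  refine ⟨r', hr', ⟨⟨U ∩ {z | ∀ᶠ y in 𝓝 z, r' y = r y}, hU.inter isOpen_setOfPred_eventually_nhds,
    fun z hz => ⟨hcl hz, heq z hz⟩, hr'.contDiffOn, fun z hz => ?_⟩, fun p hp => ?_⟩, heq⟩
  · rw [hneg z hz.1, hz.2.self_of_nhds]
  · rw [(heq p (frontier_subset_closure hp)).fderiv_eq]
    exact hgrad p hp

/-- A property that holds near the boundary holds wherever a continuous function on the domain is
small enough. -/
lemma exists_collar {Ω : Set C2} (hΩ : IsOpen Ω) (hbdd : Bornology.IsBounded Ω) {h : C2 → ℝ}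
    (hh : ContinuousOn h Ω) {P : C2 → Prop} (hP : ∀ p ∈ frontier Ω, ∀ᶠ q in 𝓝 p, P q) :
    ∃ a : ℝ, ∀ q ∈ Ω, h q ≤ a + 1 → P q := by
  set W := {q | ∀ᶠ y in 𝓝 q, P y} with hW
  have hWo : IsOpen W := isOpen_setOfPred_eventually_nhds
  have hK : IsCompact (closure Ω \ W) := hbdd.isCompact_closure.diff hWo
  have hKΩ : closure Ω \ W ⊆ Ω := fun q hq => by
    by_contra hn
    refine hq.2 (hP q ?_)
    rw [hΩ.frontier_eq]
    exact ⟨hq.1, hn⟩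
  obtain ⟨b, hb⟩ := hK.bddBelow_image (hh.mono hKΩ)
  -- Then `h q ≤ a + 1` means `h q ≤ b - 1 < b`, which excludes the compact part where `P` is not
  -- known. The threshold `a + 1` is the one past which the cutoff is constant.
  refine ⟨b - 2, fun q hq hle => ?_⟩
  by_contra hn
  have hqW : q ∉ W := fun h => hn h.self_of_nhds
  have := hb ⟨q, ⟨subset_closure hq, hqW⟩, rfl⟩
  linarith

/-- The defining function is `logConj m a (r e^{-ψ})`, which turns `-(-ρ)^τ` into `-exp (τ m(log
(-r) - ψ))` on `Ω`. Near the boundary it is still `r e^{-ψ}`, with differential `e^{-ψ} dr` where `r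
= 0`. -/
lemma mem_exponents_of_condForm_nonneg {Ω : Set C2} (hΩ : IsOpen Ω) (hbdd : Bornology.IsBounded Ω)
    {r ψ : C2 → ℝ} (hr : ContDiff ℝ ∞ r) (hψ : ContDiff ℝ ∞ ψ) (hdef : IsDefiningFunction Ω r)
    {τ : ℝ} (hτ0 : 0 < τ) (hτ1 : τ < 1)
    (hcond : ∀ p ∈ frontier Ω, ∀ᶠ q in 𝓝 p, r q < 0 → ∀ X, 0 ≤ condForm τ r ψ q X) :
    τ ∈ exponents Ω := by
  have hzero : ∀ p ∈ frontier Ω, r p = 0 := fun p hp => hdef.eq_zero hΩ hp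
  obtain ⟨⟨U, hU, hcl, -, hneg⟩, hgrad⟩ := hdef
  have hΩneg : ∀ q ∈ Ω, r q < 0 := fun q hq => (hneg q (hcl (subset_closure hq))).1 hq
  have hh : ContinuousOn (fun q => Real.log (-r q) - ψ q) Ω :=
    (hr.continuous.neg.continuousOn.log fun q hq => by
      simpa using (hΩneg q hq).ne).sub hψ.continuous.continuousOn
  obtain ⟨a, ha⟩ := exists_collar hΩ hbdd hh hcond
  obtain ⟨m, m₁, m₂, hsm, hm, hm₁, hid, h0, h1, h2, hconst⟩ := exists_concave_cutoff a
  have hρ : ContDiff ℝ ∞ fun q => r q * Real.exp (-ψ q) := hr.mul hψ.neg.exp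
  have hρneg : ∀ q, r q * Real.exp (-ψ q) < 0 ↔ r q < 0 := fun q => by
    rw [mul_neg_iff]
    have := Real.exp_pos (-ψ q)
    constructor
    · rintro (h | h)
      · linarith
      · exact h.1
    · exact fun h => Or.inr ⟨h, this⟩
  refine ⟨hτ0, hτ1, fun q => logConj m a (r q * Real.exp (-ψ q)), ⟨⟨U, hU, hcl,
    ((contDiff_logConj hsm hid).comp hρ).contDiffOn, fun z hz => ?_⟩, fun p hp hfd => ?_⟩, ?_⟩
  · rw [logConj_neg_iff hid, hρneg, hneg z hz]
  · have hev : (fun q => logConj m a (r q * Real.exp (-ψ q))) =ᶠ[𝓝 p]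
        fun q => r q * Real.exp (-ψ q) := by
      have : -Real.exp a < r p * Real.exp (-ψ p) := by
        rw [hzero p hp, zero_mul]; exact neg_lt_zero.2 (Real.exp_pos a)
      filter_upwards [hρ.continuous.continuousAt.eventually (lt_mem_nhds this)] with q hq
        using logConj_of_lt hq
    rw [hev.fderiv_eq, fderiv_fun_mul (differentiable_of_smooth hr p)
      (differentiable_of_smooth hψ.neg.exp p), hzero p hp, zero_smul, zero_add] at hfd
    exact hgrad p hp ((smul_eq_zero.1 hfd).resolve_left (Real.exp_pos _).ne')
  · have heq : ∀ q ∈ Ω, -((-logConj m a (r q * Real.exp (-ψ q))) ^ τ) =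
        -Real.exp (τ * m (Real.log (-r q) - ψ q)) := fun q hq => by
      have hq0 := hΩneg q hq
      rw [logConj_of_neg hid ((hρneg q).2 hq0), neg_neg, ← Real.exp_mul, ← neg_mul,
        Real.log_mul (by linarith) (Real.exp_pos _).ne', Real.log_exp, ← sub_eq_add_neg, mul_comm]
    have hsmooth : ContDiffOn ℝ ∞ (fun q => -Real.exp (τ * m (Real.log (-r q) - ψ q))) Ω := by
      intro q hq
      have hq' : -r q ≠ 0 := by simpa using (hΩneg q hq).ne
      exact ((contDiffAt_const.mul (hsm.contDiffAt.comp q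
        ((hr.contDiffAt.neg.log hq').sub hψ.contDiffAt))).exp.neg).contDiffWithinAt
    refine isPlurisubharmonicOn_of_sndDeriv hΩ (hsmooth.congr heq) fun p hp X => ?_
    have hev : (fun q => -((-logConj m a (r q * Real.exp (-ψ q))) ^ τ)) =ᶠ[𝓝 p]
        fun q => -Real.exp (τ * m (Real.log (-r q) - ψ q)) := by
      filter_upwards [hΩ.mem_nhds hp] with q hq using heq q hq
    rw [sndDeriv_congr hev]
    refine sndDeriv_exp_cutoff_nonneg hsm hm hm₁ h0 h1 h2 hτ0 hr hψ (hΩneg p hp) X ?_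
    -- Deep inside, the cutoff is flat; otherwise the point lies in the collar where the form is
    -- nonnegative.
    rcases le_total (a + 1) (Real.log (-r p) - ψ p) with h | h
    · exact Or.inl (hconst _ h)
    · exact Or.inr (ha p hp h (hΩneg p hp) X)

/-! ### The mixed term on the Levi-flat set -/

lemma mem_leviFlatSet {Ω : Set C2} {r : C2 → ℝ} (hr : ContDiff ℝ ∞ r)
    (hdef : IsDefiningFunction Ω r) {p : C2} (hp : p ∈ frontier Ω) (hL : leviFn r p = 0) :
    p ∈ leviFlatSet Ω := by
  refine ⟨hp, r, hdef, fun X hX => ?_⟩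
  obtain ⟨a, rfl⟩ := exists_eq_smul_tang hr ((gradSq_pos_iff hr p).2 (hdef.2 p hp)) hX
  rw [complexHessian_smul]
  have : complexHessian r p (tang r p) (tang r p) = 0 := hL
  rw [this, mul_zero]

/-- Normalising the fields only contributes a nonzero scalar, and the exchanged order of the
arguments only a conjugation. -/
lemma mixFn_eq_zero_of_fields {r r' : C2 → ℝ} (hr : ContDiff ℝ ∞ r) {p : C2}
    (heq : r =ᶠ[𝓝 p] r') (hs : 0 < gradSq r p)
    (h : complexHessian r' p (tangentialField r' p) (normalField r' p) = 0) : mixFn r p = 0 := by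
  have hw := fun j => wirt_congr heq j
  have hwb : ∀ j, wirtBar j (toComplex r) p = wirtBar j (toComplex r') p := fun j =>
    (wirtBar_congr_of_eventuallyEq (eventuallyEq_toComplex heq) j).self_of_nhds
  have ht : tangentialField r' p = ((gradNorm r p : ℂ)⁻¹) • tang r p := by
    simp only [tangentialField, tang, gradNorm, hw]
  have hn : normalField r' p = ((gradNorm r p : ℂ)⁻¹) • nrm r p := by
    simp only [normalField, nrm, gradNorm, hw, hwb]
  have hg : (gradNorm r p : ℂ) ≠ 0 := by
    have : 0 < gradNorm r p := Real.sqrt_pos.2 hs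
    exact_mod_cast this.ne'
  rw [← complexHessian_congr heq, ht, hn, complexHessian_smul] at h
  have h0 := (mul_eq_zero.1 h).resolve_left (by simp [hg])
  unfold mixFn
  rw [← conj_complexHessian hr, h0, map_zero]

end DiederichFornaess

end

theorem theorem1p2 (Ω : Set DiederichFornaess.C2) (hopen : IsOpen Ω) (hconn : IsConnected Ω)
    (hbdd : Bornology.IsBounded Ω) (hpsc : DiederichFornaess.IsPseudoconvex Ω)
    (hr : ∃ r : DiederichFornaess.C2 → ℝ, DiederichFornaess.IsDefiningFunction Ω r ∧
      ∀ p ∈ DiederichFornaess.leviFlatSet Ω,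
        DiederichFornaess.complexHessian r p (DiederichFornaess.tangentialField r p)
          (DiederichFornaess.normalField r p) = 0) :
    DiederichFornaess.index Ω = 1 := by
  open DiederichFornaess Filter Topology in
  obtain ⟨r₁, hdef₁, hflat⟩ := hr
  obtain ⟨r₂, hdef₂, hpos⟩ := hpsc
  obtain ⟨r, hr, hdef, heq⟩ := hdef₁.exists_contDiff
  obtain ⟨r₀, hr₀, hdef₀, heq₀⟩ := hdef₂.exists_contDiff
  have hzero : ∀ p ∈ frontier Ω, r p = 0 := fun p hp => hdef.eq_zero hopen hp
  -- `r₀` extends the defining function witnessing pseudoconvexity; it is linked to `r` only by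
  -- having the same negativity set near the boundary.
  have hlevi : ∀ p ∈ frontier Ω, 0 ≤ (leviFn r p).re := fun p hp => by
    have hpc := frontier_subset_closure hp
    have hsign : ∀ᶠ z in 𝓝 p, r₀ z < 0 ↔ r z < 0 := by
      obtain ⟨⟨U, hU, hcl, -, hneg⟩, -⟩ := hdef
      obtain ⟨⟨U₀, hU₀, hcl₀, -, hneg₀⟩, -⟩ := hdef₀
      filter_upwards [hU.mem_nhds (hcl hpc), hU₀.mem_nhds (hcl₀ hpc)] with z hz hz₀
      rw [← hneg z hz, ← hneg₀ z hz₀]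
    refine re_leviFn_nonneg_of_sign hr hr₀ (hzero p hp) (hdef₀.eq_zero hopen hp) hsign
      (hdef.2 p hp) (hdef₀.2 p hp) fun X hX => ?_
    rw [complexHessian_congr (heq₀ p hpc)]
    refine hpos p hp X ?_
    simpa only [IsComplexTangent, wirt_congr (heq₀ p hpc)] using hX
  have hmix : ∀ p ∈ frontier Ω, leviFn r p = 0 → mixFn r p = 0 := fun p hp hL =>
    mixFn_eq_zero_of_fields hr (heq p (frontier_subset_closure hp))
      ((gradSq_pos_iff hr p).2 (hdef.2 p hp)) (hflat p (mem_leviFlatSet hr hdef hp hL))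
  have hexp : exponents Ω = Set.Ioo 0 1 := by
    refine Set.Subset.antisymm (fun τ hτ => ⟨hτ.1, hτ.2.1⟩) fun τ hτ => ?_
    have hdef' := hdef
    obtain ⟨⟨U, hU, hcl, -, hneg⟩, hgrad⟩ := hdef'
    obtain ⟨ψ, hψ, hcond⟩ := exists_weight_condForm_nonneg hr hbdd hU hcl hneg hzero hgrad hlevi
      hmix hτ.1 hτ.2
    exact mem_exponents_of_condForm_nonneg hopen hbdd hr hψ hdef hτ.1 hτ.2 hcond
  rw [index, hexp, csSup_Ioo one_pos]
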